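/- **Setting.** Let $d\ge 1$, let $\Omega\subset[0,1]^d$ be a nonempty open set and let $\omega,f\in L^\infty(\Omega)$. For $u:\Omega\to\mathbb R$ and $\boldsymbol p:\Omega\to\mathbb R^d$ put $$\Gamma(u,\boldsymbol p;x)=\omega(x)\,|\boldsymbol p(x)-\nabla u(x)|^2+\big(-\mathrm{div}\,\boldsymbol p(x)+\omega(x)u(x)-f(x)\big)^2,$$ $$\mathcal L(u,\boldsymbol p)=\int_\Omega \Gamma(u,\boldsymbol p;x)\,dx,\qquad \widehat{\mathcal L}^N(u,\boldsymbol p)=\frac{|\Omega|}{N}\sum_{k=1}^N\Gamma(u,\boldsymbol p;\mathbf X_k),$$ where $\mathbf X_1,\dots,\mathbf X_N$ are i.i.d. uniformly distributed on $\Omega$. Let $\rho(x)=\frac1{1+e^{-x}}$ or $\rho(x)=\tanh x$. Let $\mathcal N_\rho(\mathcal D,\mathfrak n_{\mathcal D},B_\theta)$ be the set of functions $\mathbf f:\mathbb R^d\to\mathbb R^{d+1}$ implemented by a $\rho$-network of depth $\mathcal D$, i.e. $\mathbf f_0(x)=x$, $\mathbf f_\ell=\rho(A_\ell\mathbf f_{\ell-1}+\mathbf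 b_\ell)$ for $1\le \ell\le\mathcal D-1$ (with $\rho$ applied coordinatewise), $\mathbf f=A_{\mathcal D}\mathbf f_{\mathcal D-1}+\mathbf b_{\mathcal D}$, with arbitrary hidden widths, such that at most $\mathfrak n_{\mathcal D}$ entries of all the $A_\ell,\mathbf b_\ell$ are nonzero and all entries are at most $B_\theta$ in absolute value. A modification layer for this class, with constants $B_g,B_{g'},B_{\phi'}$, is a map $\phi_g:\mathbb R^d\times\mathbb R^{d+1}\to\mathbb R^{d+1}$, $C^1$ on $\Omega\times\mathbb R^{d+1}$, such that for all $\mathbf f,\widetilde{\mathbf f}\in\mathcal N_\rho(\mathcal D,\mathfrak n_{\mathcal D},B_\theta)$, all $x\in\Omega$ and all $1\le p\le d$ (with Euclidean norms, $\partial_{x_p}$ being the derivative of the composed function of $x$) $$|\phi_g(x,\mathbf f(x))|\le|\mathbf f(x)|+B_g,\qquad |\partial_{x_p}\phi_g(x,\mathbf f(x))|\le|\partial_{x_p}\mathbf f(x)|+B_{\phi'}|\mathbf f(x)|+B_{g'},$$ $$|\phi_g(x,\mathbf f(x))-\phi_g(x,\widetilde{\mathbf f}(x))|\le|\mathbf f(x)-\widetilde{\mathbf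 f}(x)|,$$ $$|\partial_{x_p}\phi_g(x,\mathbf f(x))-\partial_{x_p}\phi_g(x,\widetilde{\mathbf f}(x))|\le|\partial_{x_p}\mathbf f(x)-\partial_{x_p}\widetilde{\mathbf f}(x)|+B_{\phi'}|\mathbf f(x)-\widetilde{\mathbf f}(x)|.$$ Let $\mathcal P$ be the set of all $(u,\boldsymbol p)=\phi_g(\cdot,\mathbf f(\cdot))$ with $\mathbf f\in\mathcal N_\rho(\mathcal D,\mathfrak n_{\mathcal D},B_\theta)$, where $u$ is the first coordinate and $\boldsymbol p$ consists of the remaining $d$ coordinates. **Theorem.** (a) There is a constant $C$, depending only on $\Omega$ (hence possibly on $d$), $\omega$, $f$, $B_g$, $B_{g'}$, $B_{\phi'}$, such that for both choices of $\rho$, all integers $\mathcal D,\mathfrak n_{\mathcal D},N\ge1$, all real $B_\theta\ge1$ with $d\,\mathcal D\,\mathfrak n_{\mathcal D}B_\theta N\ge2$, and every modification layer $\phi_g$ for $\mathcal N_\rho(\mathcal D,\mathfrak n_{\mathcal D},B_\theta)$ with the constants $B_g,B_{g'},B_{\phi'}$, and for each of the two signs, $$\mathbb E_{\{\mathbf X_i\}_{i=1}^N}\sup_{(u,\boldsymbol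 p)\in\mathcal P}\pm\big[\mathcal L(u,\boldsymbol p)-\widehat{\mathcal L}^N(u,\boldsymbol p)\big]\le C\,\frac{d\sqrt{\mathcal D}\,\mathfrak n_{\mathcal D}^{2\mathcal D}B_\theta^{2\mathcal D}}{\sqrt N}\sqrt{\log\big(d\,\mathcal D\,\mathfrak n_{\mathcal D}B_\theta N\big)};$$ here $\mathcal L(u,\boldsymbol p)$ is finite on $\mathcal P$, the supremum is almost surely finite, and it is integrable. (b) If $\mathcal D\ge2$ and $\mathfrak n_{\mathcal D}\ge d$, the same holds with a constant $C$ that depends only on $B_g,B_{g'},B_{\phi'}$ and on an upper bound $M$ for $\|\omega\|_{L^\infty(\Omega)}$ and $\|f\|_{L^\infty(\Omega)}$; in particular $C$ does not depend on $d$. -/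

import Mathlib

open MeasureTheory ProbabilityTheory

noncomputable section

namespace MIM

/-- A feedforward architecture with its weights: `Net d ℓ n` consists of `ℓ` affine layers
`(A_1, b_1), …, (A_ℓ, b_ℓ)` with input width `n_0 = d` and last width `n_ℓ = n`;
the intermediate widths are arbitrary. -/
inductive Net (d : ℕ) : ℕ → ℕ → Type
  | input : Net d 0 d
  | layer {ℓ m n : ℕ} (prev : Net d ℓ m) (A : Matrix (Fin n) (Fin m) ℝ) (b : Fin n → ℝ) :
      Net d (ℓ + 1) n

namespace Net

variable {d : ℕ}

/-- The hidden layers `f_0(x) = x`, `f_ℓ(x) = ρ(A_ℓ f_{ℓ-1}(x) + b_ℓ)`,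
with `ρ` applied to every coordinate. -/
def hidden (ρ : ℝ → ℝ) (x : EuclideanSpace ℝ (Fin d)) :
    {ℓ n : ℕ} → Net d ℓ n → (Fin n → ℝ)
  | _, _, .input => fun i => x i
  | _, _, .layer prev A b => fun i => ρ (A.mulVec (hidden ρ x prev) i + b i)

/-- The function implemented by the network: the last layer `A_D f_{D-1}(x) + b_D` carries no
activation. (The network without any layer is never used; it is the identity.) -/
def output (ρ : ℝ → ℝ) (x : EuclideanSpace ℝ (Fin d)) :
    {ℓ n : ℕ} → Net d ℓ n → EuclideanSpace ℝ (Fin n)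
  | _, _, .input => x
  | _, _, .layer prev A b => WithLp.toLp 2 (fun i => A.mulVec (hidden ρ x prev) i + b i)

/-- The total number of nonzero weights, that is, of nonzero entries of all `A_ℓ` and `b_ℓ`. -/
def numNonzero : {ℓ n : ℕ} → Net d ℓ n → ℕ
  | _, _, .input => 0
  | _, _, .layer prev A b =>
      numNonzero prev + Set.ncard {ij : _ × _ | A ij.1 ij.2 ≠ 0} + Set.ncard {i | b i ≠ 0}

/-- All weights (entries of all `A_ℓ` and `b_ℓ`) are at most `B` in absolute value. -/
def WeightsBounded (B : ℝ) : {ℓ n : ℕ} → Net d ℓ n → Prop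
  | _, _, .input => True
  | _, _, .layer prev A b =>
      WeightsBounded B prev ∧ (∀ i j, |A i j| ≤ B) ∧ (∀ i, |b i| ≤ B)

end Net

/-- The class of functions `ℝ^d → ℝ^{d+1}` implemented by (unmodified) `ρ`-networks of depth `D`
with at most `nD` nonzero weights, all bounded by `B` in absolute value. -/
def networkClass (d : ℕ) (ρ : ℝ → ℝ) (D nD : ℕ) (B : ℝ) :
    Set (EuclideanSpace ℝ (Fin d) → EuclideanSpace ℝ (Fin (d + 1))) :=
  {f | ∃ net : Net d D (d + 1),
    net.numNonzero ≤ nD ∧ net.WeightsBounded B ∧ f = fun x => net.output ρ x}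

/-- The composition with the modification layer, `x ↦ φ(x, f(x))`. -/
def addModLayer {d : ℕ}
    (φ : EuclideanSpace ℝ (Fin d) → EuclideanSpace ℝ (Fin (d + 1)) →
      EuclideanSpace ℝ (Fin (d + 1)))
    (f : EuclideanSpace ℝ (Fin d) → EuclideanSpace ℝ (Fin (d + 1))) :
    EuclideanSpace ℝ (Fin d) → EuclideanSpace ℝ (Fin (d + 1)) :=
  fun x => φ x (f x)

/-- The class of modified networks. -/
def modifiedClass (d : ℕ)
    (φ : EuclideanSpace ℝ (Fin d) → EuclideanSpace ℝ (Fin (d + 1)) →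
      EuclideanSpace ℝ (Fin (d + 1)))
    (ρ : ℝ → ℝ) (D nD : ℕ) (B : ℝ) :
    Set (EuclideanSpace ℝ (Fin d) → EuclideanSpace ℝ (Fin (d + 1))) :=
  addModLayer φ '' networkClass d ρ D nD B

/-- The partial derivative `∂_{x_p} F (x)` of a (vector-valued) function. -/
def partialDeriv {d m : ℕ} (p : Fin d)
    (F : EuclideanSpace ℝ (Fin d) → EuclideanSpace ℝ (Fin m)) (x : EuclideanSpace ℝ (Fin d)) :
    EuclideanSpace ℝ (Fin m) :=
  fderiv ℝ F x (EuclideanSpace.single p 1)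

/-- The assumption on the modification layer `φ`, with constants `Bg`, `Bg'`, `Bφ'`, for functions
`f` from a class `𝒩`; here `∂_{x_p} φ(x, f(x))` is the derivative of `x ↦ φ(x, f(x))`. -/
structure IsModificationLayer {d : ℕ} (Ω : Set (EuclideanSpace ℝ (Fin d)))
    (𝒩 : Set (EuclideanSpace ℝ (Fin d) → EuclideanSpace ℝ (Fin (d + 1))))
    (φ : EuclideanSpace ℝ (Fin d) → EuclideanSpace ℝ (Fin (d + 1)) →
      EuclideanSpace ℝ (Fin (d + 1)))
    (Bg Bg' Bφ' : ℝ) : Prop where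
  contDiffOn : ContDiffOn ℝ 1
    (fun z : EuclideanSpace ℝ (Fin d) × EuclideanSpace ℝ (Fin (d + 1)) => φ z.1 z.2)
    (Ω ×ˢ Set.univ)
  bound : ∀ f ∈ 𝒩, ∀ x ∈ Ω, ‖φ x (f x)‖ ≤ ‖f x‖ + Bg
  bound_deriv : ∀ f ∈ 𝒩, ∀ x ∈ Ω, ∀ p : Fin d,
    ‖partialDeriv p (addModLayer φ f) x‖ ≤ ‖partialDeriv p f x‖ + Bφ' * ‖f x‖ + Bg'
  lipschitz : ∀ f ∈ 𝒩, ∀ f' ∈ 𝒩, ∀ x ∈ Ω, ‖φ x (f x) - φ x (f' x)‖ ≤ ‖f x - f' x‖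
  lipschitz_deriv : ∀ f ∈ 𝒩, ∀ f' ∈ 𝒩, ∀ x ∈ Ω, ∀ p : Fin d,
    ‖partialDeriv p (addModLayer φ f) x - partialDeriv p (addModLayer φ f') x‖ ≤
      ‖partialDeriv p f x - partialDeriv p f' x‖ + Bφ' * ‖f x - f' x‖

/-- The density `ω |p - ∇u|² + (-div p + ω u - f)²` of the loss at the point `x`, where
`F = (u, p)`, so that `u` is the coordinate `0` of `F` and `p_i` its coordinate `i + 1`. -/
def lossDensity {d : ℕ} (ω f : EuclideanSpace ℝ (Fin d) → ℝ)
    (F : EuclideanSpace ℝ (Fin d) → EuclideanSpace ℝ (Fin (d + 1)))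
    (x : EuclideanSpace ℝ (Fin d)) : ℝ :=
  ω x * ∑ i : Fin d, (F x i.succ - partialDeriv i F x 0) ^ 2 +
    (-(∑ i : Fin d, partialDeriv i F x i.succ) + ω x * F x 0 - f x) ^ 2

/-- The loss `𝓛(u, p) = ∫_Ω ω |p - ∇u|² + (-div p + ω u - f)² dx`. -/
def loss {d : ℕ} (Ω : Set (EuclideanSpace ℝ (Fin d))) (ω f : EuclideanSpace ℝ (Fin d) → ℝ)
    (F : EuclideanSpace ℝ (Fin d) → EuclideanSpace ℝ (Fin (d + 1))) : ℝ :=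
  ∫ x in Ω, lossDensity ω f F x

/-- The empirical loss `|Ω| / N ∑_k [ω |p - ∇u|² + (-div p + ω u - f)²](X_k)`. -/
def empiricalLoss {d N : ℕ} (Ω : Set (EuclideanSpace ℝ (Fin d)))
    (ω f : EuclideanSpace ℝ (Fin d) → ℝ)
    (F : EuclideanSpace ℝ (Fin d) → EuclideanSpace ℝ (Fin (d + 1)))
    (X : Fin N → EuclideanSpace ℝ (Fin d)) : ℝ :=
  (volume Ω).toReal / N * ∑ k : Fin N, lossDensity ω f F (X k)

/-- The joint law of `N` independent samples from the uniform distribution on `Ω`. -/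
def sampleLaw {d : ℕ} (Ω : Set (EuclideanSpace ℝ (Fin d))) (N : ℕ) :
    Measure (Fin N → EuclideanSpace ℝ (Fin d)) :=
  Measure.pi fun _ => ProbabilityTheory.cond volume Ω

/-- The set of the values `s [𝓛(u, p) - 𝓛̂^N(u, p)]`, `(u, p) ∈ 𝒢`, for the sample `X`. -/
def deviations {d N : ℕ} (Ω : Set (EuclideanSpace ℝ (Fin d)))
    (ω f : EuclideanSpace ℝ (Fin d) → ℝ)
    (𝒢 : Set (EuclideanSpace ℝ (Fin d) → EuclideanSpace ℝ (Fin (d + 1)))) (s : ℝ)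
    (X : Fin N → EuclideanSpace ℝ (Fin d)) : Set ℝ :=
  (fun F => s * (loss Ω ω f F - empiricalLoss Ω ω f F X)) '' 𝒢

/-- `E sup_{(u, p) ∈ 𝒢} ± [𝓛(u, p) - 𝓛̂^N(u, p)] ≤ R` for both signs. It is part of the claim that the
losses are finite, that the supremum is almost surely finite, and that its expectation exists. -/
structure StatisticalErrorLE {d : ℕ} (Ω : Set (EuclideanSpace ℝ (Fin d)))
    (ω f : EuclideanSpace ℝ (Fin d) → ℝ)
    (𝒢 : Set (EuclideanSpace ℝ (Fin d) → EuclideanSpace ℝ (Fin (d + 1)))) (N : ℕ) (R : ℝ) :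
    Prop where
  integrableOn : ∀ F ∈ 𝒢, IntegrableOn (lossDensity ω f F) Ω
  bddAbove : ∀ s : ℝ, (s = 1 ∨ s = -1) →
    ∀ᵐ X ∂(sampleLaw Ω N), BddAbove (deviations Ω ω f 𝒢 s X)
  integrable : ∀ s : ℝ, (s = 1 ∨ s = -1) →
    Integrable (fun X => sSup (deviations Ω ω f 𝒢 s X)) (sampleLaw Ω N)
  integral_le : ∀ s : ℝ, (s = 1 ∨ s = -1) →
    ∫ X, sSup (deviations Ω ω f 𝒢 s X) ∂(sampleLaw Ω N) ≤ R

end MIM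

end

/-! The proof is a single-scale covering argument: round the weights, apply a maximal inequality to
finitely many representatives, and choose the rounding so fine that its error is of lower order.
Chaining is not needed, because the Lipschitz constant of the parametrisation enters only through a
logarithm.

Hidden widths are arbitrary, but sparsity makes them harmless: a layer uses only those neurons of
the layer below that meet one of its nonzero weights. Hence every network of the class can be
rewritten with constant width `nD + (d + 1)`, with the same bound on the weights and no more nonzero
weights (`exists_weights`). Such a network is coded by a list of `nD` positions together with
rounded values (`exists_sparse_code`). On the cube the network and its first derivatives depend on
the weights with Lipschitz constant at most `(2 nD B)^(2D)` in the `ℓ¹` norm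
(`exists_network_code`), so the logarithm of the number of codes needed is of order `D nD log Λ`
with `Λ = d D nD B N` (`code_card_le`).

The modification layer changes sizes and distances by a constant factor. The loss density is
quadratic in the function and its derivatives, so it is bounded by a multiple of `d² K²`, with a
Lipschitz constant of order `d² K`, where `K` bounds the function and its derivatives. Hoeffding's
lemma and the maximal inequality (`integral_sSup_meanDeviation_le`) then give the rate `d² K² √(D nD
log Λ) / √N`.

This exceeds the claimed power of `d` and carries an additional `√nD`. For `D ≥ 2` there is room: a
coordinate derivative meets only one column of the first layer (`abs_tan_single_le`), whence `K` is
of order `nD^(D-1) B^D` and a factor `nD²` is left over. It absorbs `√nD`, and also `d` if `d ≤ nD`.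
For `D = 1` there is no such saving, but a single layer has at most `(d + 1)²` weights, so `√nD` may
be replaced by `d + 1`. -/

noncomputable section

namespace MIM

open scoped NNReal

/-! ### Maximal inequality and uniform law of large numbers -/

/-- The maximal inequality for finitely many sub-Gaussian random variables. -/
theorem integral_sup'_le_of_hasSubgaussianMGF {Θ ι : Type*} [MeasurableSpace Θ] {μ : Measure Θ}
    [IsProbabilityMeasure μ] {T : Finset ι} (hT : T.Nonempty) {Z : ι → Θ → ℝ} {σ L : ℝ}
    {c : ℝ≥0} (hσ : 0 < σ) (hc : (c : ℝ) ≤ σ ^ 2) (hZ : ∀ i ∈ T, HasSubgaussianMGF (Z i) c μ)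
    (hL : 0 < L) (hcard : Real.log T.card ≤ L) :
    ∫ X, (T.sup' hT Z) X ∂μ ≤ σ * √(2 * L) := by
  have hint : Integrable (T.sup' hT Z) μ :=
    Finset.sup'_induction hT Z (p := fun g => Integrable g μ) (fun _ h₁ _ h₂ => h₁.sup h₂)
      (fun i hi => (hZ i hi).integrable)
  have hs : 0 < √(2 * L) := by positivity
  -- The minimiser of `L / t + σ² t / 2`, whose minimal value is `σ √(2L)`.
  set t : ℝ := √(2 * L) / σ with ht
  have htpos : 0 < t := by positivity
  set a : ℝ := L + σ ^ 2 * t ^ 2 / 2 with ha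
  -- The inequality `1 + y ≤ exp y` takes the place of Jensen's inequality. The shift `a` is chosen
  -- so that the sum on the right has expectation at most one.
  have hpt : ∀ X, t * (T.sup' hT Z) X ≤ a - 1 + ∑ i ∈ T, Real.exp (-a) * Real.exp (t * Z i X) := by
    intro X
    obtain ⟨i, hi, hiX⟩ := Finset.exists_mem_eq_sup' hT (fun i => Z i X)
    rw [Finset.sup'_apply, hiX]
    have h1 := Real.add_one_le_exp (t * Z i X - a)
    have h2 : Real.exp (t * Z i X - a) = Real.exp (-a) * Real.exp (t * Z i X) := by
      rw [← Real.exp_add]; ring_nf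
    have h3 : Real.exp (-a) * Real.exp (t * Z i X) ≤
        ∑ i ∈ T, Real.exp (-a) * Real.exp (t * Z i X) :=
      Finset.single_le_sum (f := fun i => Real.exp (-a) * Real.exp (t * Z i X))
        (fun _ _ => by positivity) hi
    linarith
  have hi2 : ∀ i ∈ T, Integrable (fun X => Real.exp (-a) * Real.exp (t * Z i X)) μ :=
    fun i hi => ((hZ i hi).integrable_exp_mul t).const_mul _
  have hle : t * ∫ X, (T.sup' hT Z) X ∂μ ≤ a := by
    rw [← integral_const_mul]
    refine (integral_mono (hint.const_mul t)
      ((integrable_const _).add (integrable_finsetSum T hi2)) hpt).trans ?_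
    rw [integral_add' (integrable_const _) (integrable_finsetSum T hi2), integral_finsetSum T hi2]
    have h4 : ∀ i ∈ T, ∫ X, Real.exp (-a) * Real.exp (t * Z i X) ∂μ ≤ Real.exp (-L) := by
      intro i hi
      rw [integral_const_mul]
      have h5 : ∫ X, Real.exp (t * Z i X) ∂μ ≤ Real.exp (σ ^ 2 * t ^ 2 / 2) := by
        refine ((hZ i hi).mgf_le t).trans (Real.exp_le_exp.2 ?_)
        gcongr
      calc _ ≤ Real.exp (-a) * Real.exp (σ ^ 2 * t ^ 2 / 2) := by gcongr
        _ = Real.exp (-L) := by rw [← Real.exp_add, ha]; ring_nf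
    have h6 : (T.card : ℝ) ≤ Real.exp L := by
      rwa [← Real.log_le_iff_le_exp (by exact_mod_cast hT.card_pos)]
    have h7 : ∑ i ∈ T, ∫ X, Real.exp (-a) * Real.exp (t * Z i X) ∂μ ≤ 1 := by
      refine (Finset.sum_le_card_nsmul T _ _ h4).trans ?_
      rw [nsmul_eq_mul]
      calc (T.card : ℝ) * Real.exp (-L) ≤ Real.exp L * Real.exp (-L) := by gcongr
        _ = 1 := by rw [← Real.exp_add]; simp
    simp only [integral_const, probReal_univ, one_smul]
    linarith
  have hsq : √(2 * L) ^ 2 = 2 * L := Real.sq_sqrt (by positivity)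
  have hta : a = t * (σ * √(2 * L)) := by
    have h1 : σ ^ 2 * t ^ 2 = 2 * L := by rw [ht, div_pow, hsq]; field_simp
    have h2 : t * (σ * √(2 * L)) = 2 * L := by
      rw [ht, div_mul_eq_mul_div, mul_left_comm, mul_div_assoc, ← sq, hsq]
      field_simp
    rw [ha, h1, h2]
    ring
  rw [hta] at hle
  exact le_of_mul_le_mul_left hle htpos

/-- A uniformly bounded process whose index set can be coded by finitely many symbols up to any
precision has an integrable supremum, which is controlled by the supremum over representatives. -/
theorem integral_sSup_range_le {Θ ι : Type*} [MeasurableSpace Θ] {μ : Measure Θ}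
    [IsProbabilityMeasure μ] {Z : ι → Θ → ℝ} {S : Set Θ} (hS : ∀ᵐ X ∂μ, X ∈ S) {β : ℝ}
    (hβ : ∀ i, ∀ X ∈ S, |Z i X| ≤ β)
    (hcode : ∀ ε > 0, ∃ (κ : Type) (_ : Finite κ) (e : ι → κ),
      ∀ i j, e i = e j → ∀ X ∈ S, |Z i X - Z j X| ≤ ε)
    {σ L ε : ℝ} {c : ℝ≥0} (hσ : 0 < σ) (hc : (c : ℝ) ≤ σ ^ 2)
    (hZ : ∀ i, HasSubgaussianMGF (Z i) c μ) (hL : 0 < L) (hε : 0 ≤ ε)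
    {κ : Type} [Finite κ] (e : ι → κ) (he : ∀ i j, e i = e j → ∀ X ∈ S, |Z i X - Z j X| ≤ ε)
    (hcard : Real.log (Nat.card κ) ≤ L) :
    (∀ᵐ X ∂μ, BddAbove (Set.range fun i => Z i X)) ∧
      Integrable (fun X => sSup (Set.range fun i => Z i X)) μ ∧
      ∫ X, sSup (Set.range fun i => Z i X) ∂μ ≤ ε + σ * √(2 * L) := by
  classical
  have hbdd : ∀ X ∈ S, BddAbove (Set.range fun i => Z i X) := fun X hX =>
    ⟨β, by rintro _ ⟨i, rfl⟩; exact (abs_le.1 (hβ i X hX)).2⟩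
  refine ⟨hS.mono hbdd, ?_⟩
  -- For an empty class the supremum is `sSup ∅ = 0`.
  rcases isEmpty_or_nonempty ι with hι | hι
  · simp only [Set.range_eq_empty, Real.sSup_empty, integral_zero]
    exact ⟨integrable_zero _ _ _, by positivity⟩
  have hrep : ∀ (κ : Type) (_ : Finite κ) (e : ι → κ) (δ : ℝ),
      (∀ i j, e i = e j → ∀ X ∈ S, |Z i X - Z j X| ≤ δ) →
      ∃ (T : Finset ι) (hT : T.Nonempty), T.card ≤ Nat.card κ ∧
        ∀ X ∈ S, (T.sup' hT Z) X ≤ sSup (Set.range fun i => Z i X) ∧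
          sSup (Set.range fun i => Z i X) ≤ (T.sup' hT Z) X + δ := by
    intro κ _ e δ hδ
    have := Fintype.ofFinite κ
    let i₀ : ι := hι.some
    let r : κ → ι := fun k => if h : ∃ i, e i = k then h.choose else i₀
    have hr : ∀ i, e (r (e i)) = e i := fun i => by
      have h : ∃ j, e j = e i := ⟨i, rfl⟩
      simp only [r, dif_pos h]
      exact h.choose_spec
    have hT : (Finset.univ.image r).Nonempty := ⟨r (e i₀), by simp⟩
    refine ⟨Finset.univ.image r, hT, ?_, fun X hX => ⟨?_, ?_⟩⟩
    · simpa [Nat.card_eq_fintype_card] using Finset.card_image_le (s := Finset.univ) (f := r)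
    · rw [Finset.sup'_apply]
      exact Finset.sup'_le _ _ fun i _ => le_csSup (hbdd X hX) ⟨i, rfl⟩
    · refine csSup_le (Set.range_nonempty _) ?_
      rintro _ ⟨i, rfl⟩
      have h1 : Z (r (e i)) X ≤ ((Finset.univ.image r).sup' hT Z) X := by
        rw [Finset.sup'_apply]
        exact Finset.le_sup' (fun j => Z j X) (by simp)
      have h2 := (abs_le.1 (hδ i (r (e i)) (hr i).symm X hX)).2
      show Z i X ≤ _
      linarith
  -- The index set may be uncountable. By codings of precision `1 / (n + 1)` the supremum is almost
  -- everywhere a limit of finite maxima.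
  have hmeas : AEMeasurable (fun X => sSup (Set.range fun i => Z i X)) μ := by
    have hpos : ∀ n : ℕ, (0 : ℝ) < 1 / ((n : ℝ) + 1) := fun n => by positivity
    choose κ' hκ' e' he' using fun n : ℕ => hcode _ (hpos n)
    choose T hT _ hTs using fun n : ℕ => hrep (κ' n) (hκ' n) (e' n) _ (he' n)
    refine aemeasurable_of_tendsto_metrizable_ae Filter.atTop
      (f := fun n => (T n).sup' (hT n) Z) (fun n => ?_) ?_
    · exact Finset.sup'_induction (hT n) Z (p := fun g => AEMeasurable g μ)
        (fun _ h₁ _ h₂ => h₁.sup h₂) (fun i _ => (hZ i).aemeasurable)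
    · filter_upwards [hS] with X hX
      have h0 := tendsto_one_div_add_atTop_nhds_zero_nat (𝕜 := ℝ)
      refine tendsto_of_tendsto_of_tendsto_of_le_of_le
        (g := fun n : ℕ => sSup (Set.range fun i => Z i X) - 1 / ((n : ℝ) + 1))
        (h := fun _ => sSup (Set.range fun i => Z i X)) ?_ tendsto_const_nhds (fun n => ?_)
        (fun n => (hTs n X hX).1)
      · simpa using tendsto_const_nhds.sub h0
      · have := (hTs n X hX).2
        show _ - _ ≤ _
        linarith
  have hint : Integrable (fun X => sSup (Set.range fun i => Z i X)) μ := by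
    refine Integrable.of_bound hmeas.aestronglyMeasurable β ?_
    filter_upwards [hS] with X hX
    let i₀ : ι := hι.some
    rw [Real.norm_eq_abs, abs_le]
    refine ⟨(abs_le.1 (hβ i₀ X hX)).1.trans (le_csSup (hbdd X hX) ⟨i₀, rfl⟩),
      csSup_le ⟨_, i₀, rfl⟩ ?_⟩
    rintro _ ⟨i, rfl⟩
    exact (abs_le.1 (hβ i X hX)).2
  refine ⟨hint, ?_⟩
  obtain ⟨T, hT, hTc, hTs⟩ := hrep κ inferInstance e ε he
  have hlog : Real.log T.card ≤ L := by
    refine (Real.log_le_log ?_ ?_).trans hcard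
    · exact_mod_cast hT.card_pos
    · exact_mod_cast hTc
  have hTi : Integrable (T.sup' hT Z) μ :=
    Finset.sup'_induction hT Z (p := fun g => Integrable g μ) (fun _ h₁ _ h₂ => h₁.sup h₂)
      (fun i _ => (hZ i).integrable)
  have h1 : ∫ X, sSup (Set.range fun i => Z i X) ∂μ ≤ ∫ X, ((T.sup' hT Z) X + ε) ∂μ :=
    integral_mono_ae hint (hTi.add (integrable_const _)) (hS.mono fun X hX => (hTs X hX).2)
  rw [integral_add hTi (integrable_const _)] at h1
  have h2 := integral_sup'_le_of_hasSubgaussianMGF hT hσ hc (fun i _ => hZ i) hL hlog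
  simp only [integral_const, probReal_univ, one_smul] at h1
  linarith

/-- The scaled deviation of an empirical mean from the expectation. -/
def meanDeviation {E : Type*} [MeasurableSpace E] (ν : Measure E) (N : ℕ) (t : ℝ) (G : E → ℝ)
    (X : Fin N → E) : ℝ :=
  t * (∫ x, G x ∂ν - (N : ℝ)⁻¹ * ∑ k, G (X k))

/-- Hoeffding's lemma on `[-b, b]` gives each centred summand the variance proxy `b²`. Independence
adds these up to `N b²`, and the factor `-t / N` scales the sum to `t² b² / N ≤ b² / N`. -/
theorem hasSubgaussianMGF_meanDeviation {E : Type*} [MeasurableSpace E] {ν : Measure E}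
    [IsProbabilityMeasure ν] {N : ℕ} {t b : ℝ} (hN : 1 ≤ N) (ht : |t| ≤ 1) (hb : 0 ≤ b)
    {G : E → ℝ} (hG : AEMeasurable G ν) (hGb : ∀ᵐ x ∂ν, |G x| ≤ b) :
    HasSubgaussianMGF (meanDeviation ν N t G) (b ^ 2 / N).toNNReal
      (Measure.pi fun _ : Fin N => ν) := by
  have hN0 : (0 : ℝ) < N := by exact_mod_cast hN
  have h1 : HasSubgaussianMGF (fun x => G x - ∫ y, G y ∂ν) ((‖b - -b‖₊ / 2) ^ 2) ν :=
    hasSubgaussianMGF_of_mem_Icc hG (hGb.mono fun x hx => abs_le.1 hx)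
  have h2 : ∀ k : Fin N, HasSubgaussianMGF (fun X : Fin N → E => G (X k) - ∫ y, G y ∂ν)
      ((‖b - -b‖₊ / 2) ^ 2) (Measure.pi fun _ : Fin N => ν) := by
    intro k
    have hk := measurePreserving_eval (fun _ : Fin N => ν) k
    refine HasSubgaussianMGF.of_map (Y := Function.eval k) (X := fun x => G x - ∫ y, G y ∂ν)
      hk.measurable.aemeasurable ?_
    rwa [hk.map_eq]
  have h3 : iIndepFun (fun (k : Fin N) (X : Fin N → E) => G (X k) - ∫ y, G y ∂ν)
      (Measure.pi fun _ : Fin N => ν) :=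
    iIndepFun_pi (μ := fun _ : Fin N => ν) (X := fun _ x => G x - ∫ y, G y ∂ν)
      fun _ => hG.sub_const _
  have h4 := HasSubgaussianMGF.sum_of_iIndepFun h3 (s := Finset.univ) fun k _ => h2 k
  have h5 := h4.const_mul (-t / N)
  have h6 : (fun X : Fin N → E => -t / N * ∑ k, (G (X k) - ∫ y, G y ∂ν)) =
      meanDeviation ν N t G := by
    funext X
    simp only [meanDeviation, Finset.sum_sub_distrib, Finset.sum_const, Finset.card_univ,
      Fintype.card_fin, nsmul_eq_mul]
    field_simp
    ring
  rw [h6] at h5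
  refine ⟨h5.integrable_exp_mul, fun r => (h5.mgf_le r).trans (Real.exp_le_exp.2 ?_)⟩
  have h7 : ∀ p q : ℝ≥0, (p : ℝ) = (-t / N) ^ 2 → (q : ℝ) = N * b ^ 2 →
      ((p * q : ℝ≥0) : ℝ) = t ^ 2 * (b ^ 2 / N) := by
    intro p q hp hq
    rw [NNReal.coe_mul, hp, hq]
    field_simp
  have h8 : t ^ 2 ≤ 1 := by
    rw [← sq_abs]; exact pow_le_one₀ (abs_nonneg t) ht
  have h9 : ((∑ _k : Fin N, (‖b - -b‖₊ / 2) ^ 2 : ℝ≥0) : ℝ) = N * b ^ 2 := by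
    have hbb : |b - -b| / 2 = b := by
      rw [abs_of_nonneg (by linarith)]; ring
    push_cast
    simp only [Real.norm_eq_abs, hbb, Finset.sum_const, Finset.card_univ, Fintype.card_fin,
      nsmul_eq_mul]
  refine (congrArg (fun z : ℝ => z * r ^ 2 / 2) (h7 _ _ rfl h9)).le.trans ?_
  rw [Real.coe_toNNReal _ (by positivity)]
  gcongr
  exact mul_le_of_le_one_left (by positivity) h8

/-- The uniform law of large numbers in expectation, by a finite coding of the class. -/
theorem integral_sSup_meanDeviation_le {E ι : Type*} [MeasurableSpace E] {ν : Measure E}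
    [IsProbabilityMeasure ν] {G : ι → E → ℝ} {S : Set E} (hS : ∀ᵐ x ∂ν, x ∈ S)
    (hG : ∀ i, AEMeasurable (G i) ν) {b : ℝ} (hb : 0 < b) (hGb : ∀ i, ∀ x ∈ S, |G i x| ≤ b)
    (hcode : ∀ ε > 0, ∃ (κ : Type) (_ : Finite κ) (e : ι → κ),
      ∀ i j, e i = e j → ∀ x ∈ S, |G i x - G j x| ≤ ε)
    {L ε : ℝ} (hL : 0 < L) (hε : 0 ≤ ε) {κ : Type} [Finite κ] (e : ι → κ)
    (he : ∀ i j, e i = e j → ∀ x ∈ S, |G i x - G j x| ≤ ε)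
    (hcard : Real.log (Nat.card κ) ≤ L) {N : ℕ} (hN : 1 ≤ N) {t : ℝ} (ht : |t| ≤ 1) :
    (∀ᵐ X ∂(Measure.pi fun _ : Fin N => ν),
        BddAbove (Set.range fun i => meanDeviation ν N t (G i) X)) ∧
      Integrable (fun X => sSup (Set.range fun i => meanDeviation ν N t (G i) X))
        (Measure.pi fun _ : Fin N => ν) ∧
      ∫ X, sSup (Set.range fun i => meanDeviation ν N t (G i) X)
        ∂(Measure.pi fun _ : Fin N => ν) ≤ 2 * ε + b / √N * √(2 * L) := by
  have hN0 : (0 : ℝ) < N := by exact_mod_cast hN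
  have hGi : ∀ i, Integrable (G i) ν := fun i =>
    Integrable.of_bound (hG i).aestronglyMeasurable b (hS.mono fun x hx => hGb i x hx)
  have hSpi : ∀ᵐ X ∂(Measure.pi fun _ : Fin N => ν), X ∈ {X : Fin N → E | ∀ k, X k ∈ S} :=
    ae_all_iff.2 fun k => (measurePreserving_eval (fun _ : Fin N => ν) k).quasiMeasurePreserving.ae hS
  have hmean : ∀ (u : Fin N → ℝ) (r : ℝ), (∀ k, |u k| ≤ r) → |(N : ℝ)⁻¹ * ∑ k, u k| ≤ r := by
    intro u r hu
    rw [abs_mul, abs_of_pos (inv_pos.2 hN0), inv_mul_le_iff₀ hN0]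
    calc |∑ k, u k| ≤ ∑ k, |u k| := Finset.abs_sum_le_sum_abs _ _
      _ ≤ ∑ _k : Fin N, r := Finset.sum_le_sum fun k _ => hu k
      _ = N * r := by simp
  have hexp : ∀ (g : E → ℝ) (r : ℝ), (∀ x ∈ S, |g x| ≤ r) → |∫ x, g x ∂ν| ≤ r := by
    intro g r hg
    simpa using norm_integral_le_of_norm_le_const (μ := ν) (f := g) (C := r)
      (hS.mono fun x hx => hg x hx)
  -- The factor two: the expectation and the empirical mean each move by at most `δ`.
  have hdev : ∀ i j (δ : ℝ), (∀ x ∈ S, |G i x - G j x| ≤ δ) →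
      ∀ X ∈ {X : Fin N → E | ∀ k, X k ∈ S},
        |meanDeviation ν N t (G i) X - meanDeviation ν N t (G j) X| ≤ 2 * δ := by
    intro i j δ hδ X hX
    have h1 : meanDeviation ν N t (G i) X - meanDeviation ν N t (G j) X =
        t * (∫ x, (G i x - G j x) ∂ν - (N : ℝ)⁻¹ * ∑ k, (G i (X k) - G j (X k))) := by
      rw [integral_sub (hGi i) (hGi j), Finset.sum_sub_distrib]
      simp only [meanDeviation]
      ring
    rw [h1, abs_mul]
    have h2 := hexp _ δ hδ
    have h3 := hmean (fun k => G i (X k) - G j (X k)) δ fun k => hδ _ (hX k)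
    refine (mul_le_of_le_one_left (abs_nonneg _) ht).trans ((abs_sub _ _).trans ?_)
    linarith
  have hcode' : ∀ ε > 0, ∃ (κ : Type) (_ : Finite κ) (e : ι → κ), ∀ i j, e i = e j →
      ∀ X ∈ {X : Fin N → E | ∀ k, X k ∈ S},
        |meanDeviation ν N t (G i) X - meanDeviation ν N t (G j) X| ≤ ε := by
    intro δ hδ
    obtain ⟨κ', hκ', e', he'⟩ := hcode (δ / 2) (by positivity)
    refine ⟨κ', hκ', e', fun i j hij X hX => ?_⟩
    have := hdev i j _ (he' i j hij) X hX
    linarith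
  refine integral_sSup_range_le hSpi (β := 2 * b) (fun i X hX => ?_) hcode'
    (c := (b ^ 2 / N).toNNReal) (by positivity) ?_
    (fun i => hasSubgaussianMGF_meanDeviation hN ht hb.le (hG i) (hS.mono fun x hx => hGb i x hx))
    hL (by positivity) e (fun i j hij X hX => hdev i j ε (he i j hij) X hX) hcard
  · have h2 := hexp _ b (hGb i)
    have h3 := hmean (fun k => G i (X k)) b fun k => hGb i _ (hX k)
    rw [meanDeviation, abs_mul]
    refine (mul_le_of_le_one_left (abs_nonneg _) ht).trans ((abs_sub _ _).trans ?_)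
    linarith
  · rw [div_pow, Real.sq_sqrt hN0.le, Real.coe_toNNReal _ (by positivity)]

/-! ### The two activation functions -/

/-- An activation function bounded by one, with a derivative that is bounded by one and
nonexpansive. -/
structure IsTameActivation (ρ ρ' : ℝ → ℝ) : Prop where
  abs_le_one : ∀ a, |ρ a| ≤ 1
  hasDerivAt : ∀ a, HasDerivAt ρ (ρ' a) a
  abs_deriv_le_one : ∀ a, |ρ' a| ≤ 1
  abs_deriv_sub_le : ∀ a b, |ρ' a - ρ' b| ≤ |a - b|

theorem abs_sub_le_of_hasDerivAt {g g' : ℝ → ℝ} (h : ∀ a, HasDerivAt g (g' a) a)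
    (h' : ∀ a, |g' a| ≤ 1) (a b : ℝ) : |g a - g b| ≤ |a - b| := by
  have := Convex.norm_image_sub_le_of_norm_hasDerivWithin_le (f := g) (f' := g') (s := Set.univ)
    (C := 1) (fun x _ => (h x).hasDerivWithinAt) (fun x _ => h' x) convex_univ
    (Set.mem_univ b) (Set.mem_univ a)
  simpa using this

theorem IsTameActivation.abs_sub_le {ρ ρ' : ℝ → ℝ} (h : IsTameActivation ρ ρ') (a b : ℝ) :
    |ρ a - ρ b| ≤ |a - b| :=
  abs_sub_le_of_hasDerivAt h.hasDerivAt h.abs_deriv_le_one a b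

theorem isTameActivation_sigmoid :
    IsTameActivation Real.sigmoid fun x => Real.sigmoid x * (1 - Real.sigmoid x) := by
  have h0 : ∀ a, 0 ≤ Real.sigmoid a := Real.sigmoid_nonneg
  have h1 : ∀ a, Real.sigmoid a ≤ 1 := Real.sigmoid_le_one
  have hd : ∀ a, |Real.sigmoid a * (1 - Real.sigmoid a)| ≤ 1 := fun a => by
    rw [abs_le]
    constructor <;> nlinarith [h0 a, h1 a]
  refine ⟨fun a => by rw [abs_of_nonneg (h0 a)]; exact h1 a, Real.hasDerivAt_sigmoid, hd, fun a b => ?_⟩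
  have h2 := abs_sub_le_of_hasDerivAt Real.hasDerivAt_sigmoid hd a b
  -- The second factor lies in `[-1, 1]`, so the derivative inherits the Lipschitz bound of the
  -- sigmoid.
  have h3 : Real.sigmoid a * (1 - Real.sigmoid a) - Real.sigmoid b * (1 - Real.sigmoid b) =
      (Real.sigmoid a - Real.sigmoid b) * (1 - Real.sigmoid a - Real.sigmoid b) := by ring
  rw [h3, abs_mul]
  refine (mul_le_of_le_one_right (abs_nonneg _) ?_).trans h2
  rw [abs_le]
  constructor <;> linarith [h0 a, h1 a, h0 b, h1 b]

theorem hasDerivAt_tanh (x : ℝ) : HasDerivAt Real.tanh (1 - Real.tanh x ^ 2) x := by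
  have h0 : Real.cosh x ≠ 0 := (Real.cosh_pos x).ne'
  have h := (Real.hasDerivAt_sinh x).div (Real.hasDerivAt_cosh x) h0
  have h1 : (Real.sinh / Real.cosh) = Real.tanh := by
    funext y; exact (Real.tanh_eq_sinh_div_cosh y).symm
  rw [h1] at h
  have h2 : 1 - Real.tanh x ^ 2 =
      (Real.cosh x * Real.cosh x - Real.sinh x * Real.sinh x) / Real.cosh x ^ 2 := by
    rw [Real.tanh_eq_sinh_div_cosh]
    field_simp
  rwa [h2]

theorem isTameActivation_tanh : IsTameActivation Real.tanh fun x => 1 - Real.tanh x ^ 2 := by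
  have h1 : ∀ a, Real.tanh a ^ 2 ≤ 1 := fun a => by
    rw [Real.tanh_eq_sinh_div_cosh, div_pow, div_le_one (by positivity [Real.cosh_pos a])]
    linarith [Real.cosh_sq a]
  have h2 : ∀ a, |Real.tanh a| ≤ 1 := fun a => (sq_le_one_iff_abs_le_one _).1 (h1 a)
  have hd : ∀ a, HasDerivAt (fun x => 1 - Real.tanh x ^ 2)
      (-(2 * Real.tanh a * (1 - Real.tanh a ^ 2))) a := fun a => by
    have := ((hasDerivAt_tanh a).pow 2).const_sub 1
    simpa using this
  refine ⟨h2, hasDerivAt_tanh, fun a => ?_, abs_sub_le_of_hasDerivAt hd fun a => ?_⟩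
  · rw [abs_le]
    constructor <;> nlinarith [h1 a]
  · obtain ⟨h3, h4⟩ := abs_le.1 (h2 a)
    -- With `t = tanh a`, one has `2t(1 - t²) = (3t - 4t³)/2 + t/2`, and `1 ± (3t - 4t³) = (1 ∓
    -- t)(2t ± 1)²` is nonnegative on `[-1, 1]`.
    rw [abs_neg, abs_le]
    constructor
    · nlinarith [mul_nonneg (sub_nonneg.2 h4) (sq_nonneg (2 * Real.tanh a + 1)),
        mul_nonneg (by linarith : 0 ≤ 1 + Real.tanh a) (sq_nonneg (2 * Real.tanh a - 1))]
    · nlinarith [mul_nonneg (sub_nonneg.2 h4) (sq_nonneg (2 * Real.tanh a + 1)),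
        mul_nonneg (by linarith : 0 ≤ 1 + Real.tanh a) (sq_nonneg (2 * Real.tanh a - 1))]

/-! ### Networks of constant width -/

/-- Weights of a network whose layers all have width `W`; the index `none` is the bias. -/
abbrev Weights (W : ℕ) := ℕ → Fin W → Option (Fin W) → ℝ

/-- The input vector, padded by zeros. -/
def pad {d : ℕ} (W : ℕ) (x : EuclideanSpace ℝ (Fin d)) (r : Fin W) : ℝ :=
  if h : (r : ℕ) < d then x ⟨r, h⟩ else 0

/-- The hidden layers of a network of constant width. -/
def act {d W : ℕ} (ρ : ℝ → ℝ) (θ : Weights W) (x : EuclideanSpace ℝ (Fin d)) : ℕ → Fin W → ℝ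
  | 0 => pad W x
  | ℓ + 1 => fun r => ρ (∑ c, θ ℓ r c * c.elim 1 (act ρ θ x ℓ))

/-- The derivatives of the hidden layers in the direction `v`. -/
def tan {d W : ℕ} (ρ ρ' : ℝ → ℝ) (θ : Weights W) (x v : EuclideanSpace ℝ (Fin d)) :
    ℕ → Fin W → ℝ
  | 0 => pad W v
  | ℓ + 1 => fun r => ρ' (∑ c, θ ℓ r c * c.elim 1 (act ρ θ x ℓ)) *
      ∑ c, θ ℓ r c * c.elim 0 (tan ρ ρ' θ x v ℓ)

/-- Allows a new top layer to be written into a weight family without disturbing the layers below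
it. -/
theorem act_congr {d W : ℕ} (ρ : ℝ → ℝ) {θ θ' : Weights W} (x : EuclideanSpace ℝ (Fin d)) {ℓ : ℕ}
    (h : ∀ k < ℓ, θ k = θ' k) : act ρ θ x ℓ = act ρ θ' x ℓ := by
  induction ℓ with
  | zero => rfl
  | succ ℓ ih =>
    funext r
    simp only [act]
    rw [ih fun k hk => h k (hk.trans (Nat.lt_succ_self _)), h ℓ (Nat.lt_succ_self _)]

theorem hasFDerivAt_affine {d W : ℕ} (w : Option (Fin W) → ℝ)
    {u : EuclideanSpace ℝ (Fin d) → Fin W → ℝ} {u' : Fin W → EuclideanSpace ℝ (Fin d) →L[ℝ] ℝ}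
    {x : EuclideanSpace ℝ (Fin d)} (hu : ∀ k, HasFDerivAt (fun y => u y k) (u' k) x) :
    HasFDerivAt (fun y => ∑ c, w c * c.elim 1 (u y))
      (∑ c : Option (Fin W), w c • c.elim 0 u') x := by
  refine HasFDerivAt.fun_sum fun c _ => ?_
  cases c with
  | none => simpa using hasFDerivAt_const (w none * 1) x
  | some k => exact (hu k).const_mul (w (some k))

theorem affine_fderiv_apply {d W : ℕ} (w : Option (Fin W) → ℝ)
    (u' : Fin W → EuclideanSpace ℝ (Fin d) →L[ℝ] ℝ) (v : EuclideanSpace ℝ (Fin d)) :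
    (∑ c : Option (Fin W), w c • c.elim 0 u') v = ∑ c, w c * c.elim 0 (fun k => u' k v) := by
  rw [sum_apply]
  refine Finset.sum_congr rfl fun c _ => ?_
  cases c <;> simp

theorem exists_hasFDerivAt_act {d W : ℕ} {ρ ρ' : ℝ → ℝ} (hρ : IsTameActivation ρ ρ')
    (θ : Weights W) (x : EuclideanSpace ℝ (Fin d)) (ℓ : ℕ) :
    ∃ u' : Fin W → EuclideanSpace ℝ (Fin d) →L[ℝ] ℝ,
      (∀ r, HasFDerivAt (fun y => act ρ θ y ℓ r) (u' r) x) ∧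
        ∀ v r, u' r v = tan ρ ρ' θ x v ℓ r := by
  induction ℓ with
  | zero =>
    refine ⟨fun r => if h : (r : ℕ) < d then EuclideanSpace.proj ⟨r, h⟩ else 0, fun r => ?_,
      fun v r => ?_⟩
    · simp only [act, pad]
      split_ifs with h
      · exact (EuclideanSpace.proj (𝕜 := ℝ) (⟨r, h⟩ : Fin d)).hasFDerivAt
      · exact hasFDerivAt_const _ _
    · simp only [tan, pad]
      split_ifs with h <;> simp
  | succ ℓ ih =>
    obtain ⟨u', hu', htan⟩ := ih
    refine ⟨fun r => ρ' (∑ c, θ ℓ r c * c.elim 1 (act ρ θ x ℓ)) •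
      ∑ c : Option (Fin W), θ ℓ r c • c.elim 0 u', fun r => ?_, fun v r => ?_⟩
    · exact (hρ.hasDerivAt _).comp_hasFDerivAt x (hasFDerivAt_affine (θ ℓ r) hu')
    · rw [smul_apply, affine_fderiv_apply]
      simp only [htan, tan, smul_eq_mul]

/-! ### Bounds -/

theorem abs_sum_mul_le {ι : Type*} [Fintype ι] (w u : ι → ℝ) {U : ℝ} (hu : ∀ c, |u c| ≤ U) :
    |∑ c, w c * u c| ≤ (∑ c, |w c|) * U := by
  rw [Finset.sum_mul]
  refine (Finset.abs_sum_le_sum_abs _ _).trans (Finset.sum_le_sum fun c _ => ?_)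
  rw [abs_mul]
  exact mul_le_mul_of_nonneg_left (hu c) (abs_nonneg _)

theorem abs_sum_mul_sub_sum_mul_le {ι : Type*} [Fintype ι] (w w' u u' : ι → ℝ) {e U : ℝ}
    (hu : ∀ c, |u c - u' c| ≤ e) (hu' : ∀ c, |u' c| ≤ U) :
    |∑ c, w c * u c - ∑ c, w' c * u' c| ≤ (∑ c, |w c|) * e + (∑ c, |w c - w' c|) * U := by
  have h : ∑ c, w c * u c - ∑ c, w' c * u' c =
      ∑ c, w c * (u c - u' c) + ∑ c, (w c - w' c) * u' c := by
    rw [← Finset.sum_add_distrib, ← Finset.sum_sub_distrib]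
    exact Finset.sum_congr rfl fun c _ => by ring
  rw [h]
  exact (abs_add_le _ _).trans (add_le_add (abs_sum_mul_le w _ hu) (abs_sum_mul_le _ u' hu'))

theorem abs_elim_le {W : ℕ} {a U : ℝ} {u : Fin W → ℝ} (ha : |a| ≤ U) (hu : ∀ r, |u r| ≤ U)
    (c : Option (Fin W)) : |c.elim a u| ≤ U := by
  cases c with
  | none => exact ha
  | some k => exact hu k

theorem abs_elim_sub_elim_le {W : ℕ} {a U : ℝ} {u u' : Fin W → ℝ} (hU : 0 ≤ U)
    (hu : ∀ r, |u r - u' r| ≤ U) (c : Option (Fin W)) : |c.elim a u - c.elim a u'| ≤ U := by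
  cases c with
  | none => simpa using hU
  | some k => exact hu k

theorem abs_act_le_one {d W : ℕ} {ρ ρ' : ℝ → ℝ} (hρ : IsTameActivation ρ ρ') (θ : Weights W)
    {x : EuclideanSpace ℝ (Fin d)} (hx : ∀ i, |x i| ≤ 1) (ℓ : ℕ) (r : Fin W) :
    |act ρ θ x ℓ r| ≤ 1 := by
  cases ℓ with
  | zero =>
    simp only [act, pad]
    split_ifs with h
    · exact hx _
    · simp
  | succ ℓ => exact hρ.abs_le_one _

theorem abs_tan_le {d W m : ℕ} {ρ ρ' : ℝ → ℝ} (hρ : IsTameActivation ρ ρ') {θ : Weights W} {R : ℝ}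
    (hR : 1 ≤ R) (hθ : ∀ k < m, ∀ r, ∑ c, |θ k r c| ≤ R)
    (x : EuclideanSpace ℝ (Fin d)) {v : EuclideanSpace ℝ (Fin d)} (hv : ∀ i, |v i| ≤ 1) {ℓ : ℕ}
    (hℓ : ℓ ≤ m) (r : Fin W) : |tan ρ ρ' θ x v ℓ r| ≤ R ^ ℓ := by
  induction ℓ generalizing r with
  | zero =>
    simp only [tan, pad]
    split_ifs with h
    · simpa using hv _
    · simp
  | succ ℓ ih =>
    have hpos : (0 : ℝ) ≤ R ^ ℓ := by positivity
    simp only [tan, abs_mul]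
    refine (mul_le_of_le_one_left (abs_nonneg _) (hρ.abs_deriv_le_one _)).trans ?_
    refine (abs_sum_mul_le _ _ (U := R ^ ℓ) fun c => ?_).trans ?_
    · exact abs_elim_le (by simpa using hpos) (fun r => ih (by omega) r) c
    · rw [pow_succ']
      exact mul_le_mul_of_nonneg_right (hθ ℓ hℓ r) hpos

/-- In a coordinate direction the first layer sees a single column, so it contributes one entry, of
size `B`, and not a full row sum of size `R`. With `R = nD * B` this saves one power of `nD`, on
which the final rate depends. -/
theorem abs_tan_single_le {d W m : ℕ} {ρ ρ' : ℝ → ℝ} (hρ : IsTameActivation ρ ρ') {θ : Weights W}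
    {R B : ℝ} (hR : 1 ≤ R) (hB : 0 ≤ B) (hθ : ∀ k < m, ∀ r, ∑ c, |θ k r c| ≤ R)
    (hθB : ∀ k r c, |θ k r c| ≤ B) (x : EuclideanSpace ℝ (Fin d)) (p : Fin d) {ℓ : ℕ}
    (hℓ : ℓ + 1 ≤ m) (r : Fin W) :
    |tan ρ ρ' θ x (EuclideanSpace.single p 1) (ℓ + 1) r| ≤ B * R ^ ℓ := by
  induction ℓ generalizing r with
  | zero =>
    simp only [tan, abs_mul]
    refine (mul_le_of_le_one_left (abs_nonneg _) (hρ.abs_deriv_le_one _)).trans ?_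
    rw [Fintype.sum_option]
    simp only [Option.elim_none, mul_zero, zero_add, Option.elim_some, pow_zero, mul_one]
    by_cases hp : (p : ℕ) < W
    · rw [Finset.sum_eq_single (⟨p, hp⟩ : Fin W)]
      · simpa [pad] using hθB 0 r (some ⟨p, hp⟩)
      · intro k _ hk
        have : ∀ h : (k : ℕ) < d, (⟨k, h⟩ : Fin d) ≠ p := fun h hkp =>
          hk (Fin.ext (by simp [← hkp]))
        simp only [pad]
        split_ifs with h
        · simp [this h]
        · simp
      · simp
    · rw [Finset.sum_eq_zero]
      · simpa using hB
      · intro k _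
        have : ∀ h : (k : ℕ) < d, (⟨k, h⟩ : Fin d) ≠ p := fun h hkp =>
          hp (by rw [← hkp]; exact k.2)
        simp only [pad]
        split_ifs with h
        · simp [this h]
        · simp
  | succ ℓ ih =>
    have hpos : (0 : ℝ) ≤ B * R ^ ℓ := by positivity
    rw [tan]
    simp only [abs_mul]
    refine (mul_le_of_le_one_left (abs_nonneg _) (hρ.abs_deriv_le_one _)).trans ?_
    refine (abs_sum_mul_le _ _ (U := B * R ^ ℓ) fun c => ?_).trans ?_
    · exact abs_elim_le (by simpa using hpos) (fun r => ih (by omega) r) c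
    · calc _ ≤ R * (B * R ^ ℓ) := mul_le_mul_of_nonneg_right (hθ _ hℓ r) hpos
        _ = B * R ^ (ℓ + 1) := by ring

/-- Two weight families are `δ`-close on the first `m` layers, with `ℓ¹` norms at most `R`. -/
structure CloseWeights {W : ℕ} (m : ℕ) (R δ : ℝ) (θ θ' : Weights W) : Prop where
  left : ∀ k < m, ∑ r, ∑ c, |θ k r c| ≤ R
  right : ∀ k < m, ∑ r, ∑ c, |θ' k r c| ≤ R
  sub : ∀ k < m, ∑ r, ∑ c, |θ k r c - θ' k r c| ≤ δ

theorem row_le {W : ℕ} {g : Fin W → Option (Fin W) → ℝ} {R : ℝ} (h : ∑ r, ∑ c, |g r c| ≤ R)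
    (r : Fin W) : ∑ c, |g r c| ≤ R :=
  (Finset.single_le_sum (f := fun r => ∑ c, |g r c|)
    (fun _ _ => Finset.sum_nonneg fun _ _ => abs_nonneg _) (Finset.mem_univ r)).trans h

/-- Since activations are bounded by one and nonexpansive, the error obeys `e_(ℓ+1) ≤ R e_ℓ + δ`;
the factor `2R` per layer absorbs both terms. -/
theorem abs_act_sub_le {d W m : ℕ} {ρ ρ' : ℝ → ℝ} (hρ : IsTameActivation ρ ρ') {θ θ' : Weights W}
    {R δ : ℝ} (hR : 1 ≤ R) (hδ : 0 ≤ δ) (h : CloseWeights m R δ θ θ')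
    {x : EuclideanSpace ℝ (Fin d)} (hx : ∀ i, |x i| ≤ 1) {ℓ : ℕ} (hℓ : ℓ ≤ m) (r : Fin W) :
    |act ρ θ x ℓ r - act ρ θ' x ℓ r| ≤ (2 * R) ^ ℓ * δ := by
  induction ℓ generalizing r with
  | zero => simpa [act] using hδ
  | succ ℓ ih =>
    have hpos : (0 : ℝ) ≤ (2 * R) ^ ℓ * δ := by positivity
    simp only [act]
    refine (hρ.abs_sub_le _ _).trans ?_
    refine (abs_sum_mul_sub_sum_mul_le _ _ _ _ (e := (2 * R) ^ ℓ * δ) (U := 1)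
      (abs_elim_sub_elim_le hpos (ih (by omega)))
      (abs_elim_le (by simp) (abs_act_le_one hρ θ' hx ℓ))).trans ?_
    have h1 := row_le (h.left ℓ hℓ) r
    have h2 := row_le (h.sub ℓ hℓ) r
    have h3 : (1 : ℝ) ≤ (2 * R) ^ ℓ := one_le_pow₀ (by linarith)
    have h4 : δ ≤ R * ((2 * R) ^ ℓ * δ) := by
      calc δ = 1 * (1 * δ) := by ring
        _ ≤ R * ((2 * R) ^ ℓ * δ) := by gcongr
    calc _ ≤ R * ((2 * R) ^ ℓ * δ) + δ * 1 := by gcongr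
      _ ≤ (2 * R) ^ (ℓ + 1) * δ := by rw [pow_succ]; linarith

theorem abs_preact_sub_le {d W m : ℕ} {ρ ρ' : ℝ → ℝ} (hρ : IsTameActivation ρ ρ')
    {θ θ' : Weights W} {R δ : ℝ} (hR : 1 ≤ R) (hδ : 0 ≤ δ) (h : CloseWeights m R δ θ θ')
    {x : EuclideanSpace ℝ (Fin d)} (hx : ∀ i, |x i| ≤ 1) {ℓ : ℕ} (hℓ : ℓ ≤ m) (r : Fin W) :
    |∑ c, θ ℓ r c * c.elim 1 (act ρ θ x ℓ) - ∑ c, θ' ℓ r c * c.elim 1 (act ρ θ' x ℓ)| ≤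
      (∑ c, |θ ℓ r c|) * ((2 * R) ^ ℓ * δ) + ∑ c, |θ ℓ r c - θ' ℓ r c| := by
  have hpos : (0 : ℝ) ≤ (2 * R) ^ ℓ * δ := by positivity
  have := abs_sum_mul_sub_sum_mul_le (θ ℓ r) (θ' ℓ r) _ _ (e := (2 * R) ^ ℓ * δ) (U := 1)
      (abs_elim_sub_elim_le (a := 1) hpos (abs_act_sub_le hρ hR hδ h hx hℓ))
      (abs_elim_le abs_one.le (abs_act_le_one hρ θ' hx ℓ))
  rwa [mul_one] at this

/-- The error of `ρ'` at the perturbed preactivation, of order `(2R)^(ℓ+1) δ`, is multiplied by a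
tangent of size `R^(ℓ+1)`. This product doubles the exponent. -/
theorem abs_tan_sub_le {d W m : ℕ} {ρ ρ' : ℝ → ℝ} (hρ : IsTameActivation ρ ρ') {θ θ' : Weights W}
    {R δ : ℝ} (hR : 1 ≤ R) (hδ : 0 ≤ δ) (h : CloseWeights m R δ θ θ')
    {x v : EuclideanSpace ℝ (Fin d)} (hx : ∀ i, |x i| ≤ 1) (hv : ∀ i, |v i| ≤ 1) {ℓ : ℕ}
    (hℓ : ℓ ≤ m) (r : Fin W) :
    |tan ρ ρ' θ x v ℓ r - tan ρ ρ' θ' x v ℓ r| ≤ (2 * R) ^ (2 * ℓ) * δ := by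
  induction ℓ generalizing r with
  | zero => simpa [tan] using hδ
  | succ ℓ ih =>
    have hR0 : 0 ≤ R := by linarith
    have hrow := row_le (h.left ℓ hℓ) r
    have hsub := row_le (h.sub ℓ hℓ) r
    have htan' : ∀ c : Option (Fin W), |c.elim 0 (tan ρ ρ' θ' x v ℓ)| ≤ R ^ ℓ :=
      abs_elim_le (by rw [abs_zero]; positivity)
        (abs_tan_le hρ hR (fun k hk => row_le (h.right k hk)) x hv (by omega))
    have hA : |∑ c, θ ℓ r c * c.elim 0 (tan ρ ρ' θ x v ℓ) -
        ∑ c, θ' ℓ r c * c.elim 0 (tan ρ ρ' θ' x v ℓ)| ≤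
        R * ((2 * R) ^ (2 * ℓ) * δ) + δ * R ^ ℓ := by
      refine (abs_sum_mul_sub_sum_mul_le _ _ _ _ (e := (2 * R) ^ (2 * ℓ) * δ)
        (abs_elim_sub_elim_le (by positivity) (ih (by omega))) htan').trans ?_
      gcongr
    have hB : |∑ c, θ' ℓ r c * c.elim 0 (tan ρ ρ' θ' x v ℓ)| ≤ R * R ^ ℓ := by
      refine (abs_sum_mul_le _ _ htan').trans ?_
      have := row_le (h.right ℓ hℓ) r
      gcongr
    have h4 : δ ≤ R * ((2 * R) ^ ℓ * δ) := by
      have h3 : (1 : ℝ) ≤ (2 * R) ^ ℓ := one_le_pow₀ (by linarith)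
      calc δ = 1 * (1 * δ) := by ring
        _ ≤ R * ((2 * R) ^ ℓ * δ) := by gcongr
    have hZ := abs_preact_sub_le hρ hR hδ h hx (by omega : ℓ ≤ m) r
    have hZ' := (hρ.abs_deriv_sub_le _ _).trans
      (hZ.trans (c := (2 * R) ^ (ℓ + 1) * δ) (by
        calc _ ≤ R * ((2 * R) ^ ℓ * δ) + δ := by gcongr
          _ ≤ (2 * R) ^ (ℓ + 1) * δ := by rw [pow_succ]; linarith))
    simp only [tan]
    set z := ∑ c, θ ℓ r c * c.elim 1 (act ρ θ x ℓ)
    set z' := ∑ c, θ' ℓ r c * c.elim 1 (act ρ θ' x ℓ)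
    set a := ∑ c, θ ℓ r c * c.elim 0 (tan ρ ρ' θ x v ℓ)
    set a' := ∑ c, θ' ℓ r c * c.elim 0 (tan ρ ρ' θ' x v ℓ)
    -- The three resulting errors cost `R²`, `R²` and `2R²` times `(2R)^(2ℓ) δ`; their sum `4R²` is
    -- exactly the growth of the bound from `ℓ` to `ℓ + 1`.
    have h5 : ρ' z * a - ρ' z' * a' = ρ' z * (a - a') + (ρ' z - ρ' z') * a' := by ring
    have h6 : |ρ' z * (a - a')| ≤ R * ((2 * R) ^ (2 * ℓ) * δ) + δ * R ^ ℓ := by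
      rw [abs_mul]
      exact (mul_le_of_le_one_left (abs_nonneg _) (hρ.abs_deriv_le_one _)).trans hA
    have h7 : |(ρ' z - ρ' z') * a'| ≤ (2 * R) ^ (ℓ + 1) * δ * (R * R ^ ℓ) := by
      rw [abs_mul]
      gcongr
    rw [h5]
    refine (abs_add_le _ _).trans ((add_le_add h6 h7).trans ?_)
    have e1 : R ^ ℓ ≤ (2 * R) ^ ℓ := pow_le_pow_left₀ hR0 (by linarith) ℓ
    have e2 : (1 : ℝ) ≤ (2 * R) ^ ℓ := one_le_pow₀ (by linarith)
    have e3 : (2 * R) ^ (2 * (ℓ + 1)) = 4 * R ^ 2 * ((2 * R) ^ ℓ * (2 * R) ^ ℓ) := by ring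
    have e4 : (2 * R) ^ (2 * ℓ) = (2 * R) ^ ℓ * (2 * R) ^ ℓ := by ring
    have e5 : (2 * R) ^ (ℓ + 1) = 2 * R * (2 * R) ^ ℓ := by ring
    rw [e3, e4, e5]
    set y := (2 * R) ^ ℓ
    have hy : 0 ≤ y := by positivity
    have f1 : R * (y * y * δ) ≤ R ^ 2 * (y * y * δ) := by
      have : R ≤ R ^ 2 := by nlinarith
      gcongr
    have f2 : δ * R ^ ℓ ≤ R ^ 2 * (y * y * δ) := by
      have : (1 : ℝ) ≤ R ^ 2 := one_le_pow₀ hR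
      calc δ * R ^ ℓ ≤ δ * y := by gcongr
        _ = 1 * (1 * y * δ) := by ring
        _ ≤ R ^ 2 * (y * y * δ) := by gcongr
    have f3 : 2 * R * y * δ * (R * R ^ ℓ) ≤ 2 * (R ^ 2 * (y * y * δ)) := by
      calc 2 * R * y * δ * (R * R ^ ℓ) ≤ 2 * R * y * δ * (R * y) := by gcongr
        _ = _ := by ring
    linarith

/-! ### Normal form of a network -/

/-- Partial relabelling of at most `W` elements by `Fin W`. -/
theorem exists_relabelling {α : Type*} {W : ℕ} (J : Finset α) (hJ : J.card ≤ W) :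
    ∃ g : Fin W → Option α, (∀ j ∈ J, ∃ r, g r = some j) ∧
      ∀ r r' j, g r = some j → g r' = some j → r = r' := by
  classical
  refine ⟨fun r => if h : (r : ℕ) < J.card then some (J.equivFin.symm ⟨r, h⟩) else none,
    fun j hj => ?_, fun r r' j hr hr' => ?_⟩
  · refine ⟨⟨J.equivFin ⟨j, hj⟩, (J.equivFin ⟨j, hj⟩).2.trans_le hJ⟩, ?_⟩
    simp
  · dsimp only at hr hr'
    split_ifs at hr hr' with h h'
    simp only [Option.some.injEq] at hr hr'
    have := J.equivFin.symm.injective (Subtype.ext (hr.trans hr'.symm))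
    exact Fin.ext (by simpa using this)

/-- A layer whose rows and columns are relabelled. -/
def relabel {W m n : ℕ} (g₂ : Fin W → Option (Fin n)) (g₁ : Fin W → Option (Fin m))
    (A : Matrix (Fin n) (Fin m) ℝ) (b : Fin n → ℝ) (r : Fin W) (c : Option (Fin W)) : ℝ :=
  (g₂ r).elim 0 fun i => c.elim (b i) fun k => (g₁ k).elim 0 (A i)

theorem abs_relabel_le {W m n : ℕ} (g₂ : Fin W → Option (Fin n)) (g₁ : Fin W → Option (Fin m))
    {A : Matrix (Fin n) (Fin m) ℝ} {b : Fin n → ℝ} {B : ℝ} (hB : 0 ≤ B) (hA : ∀ i j, |A i j| ≤ B)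
    (hb : ∀ i, |b i| ≤ B) (r : Fin W) (c : Option (Fin W)) : |relabel g₂ g₁ A b r c| ≤ B := by
  unfold relabel
  cases g₂ r with
  | none => simpa using hB
  | some i =>
    cases c with
    | none => exact hb i
    | some k =>
      cases h : g₁ k with
      | none => simpa [h] using hB
      | some j => simpa [h] using hA i j

/-- A column of `A` without a label is zero, and a slot without a label carries weight zero, so the
nonzero terms of both sums correspond bijectively. -/
theorem sum_relabel_mul {W m n : ℕ} {g₂ : Fin W → Option (Fin n)} {g₁ : Fin W → Option (Fin m)}
    {A : Matrix (Fin n) (Fin m) ℝ} {b : Fin n → ℝ}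
    (hinj : ∀ r r' j, g₁ r = some j → g₁ r' = some j → r = r')
    (hcov : ∀ j, (∃ i, A i j ≠ 0) → ∃ r, g₁ r = some j) {h : Fin W → ℝ} {h' : Fin m → ℝ}
    (hh : ∀ r j, g₁ r = some j → h r = h' j) {r : Fin W} {i : Fin n} (hr : g₂ r = some i) :
    ∑ c, relabel g₂ g₁ A b r c * c.elim 1 h = A.mulVec h' i + b i := by
  rw [Fintype.sum_option, add_comm]
  simp only [relabel, hr, Option.elim_some, Option.elim_none, mul_one, Matrix.mulVec, dotProduct]
  congr 1
  refine (Finset.sum_bij_ne_zero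
    (fun j _ hj => (hcov j ⟨i, left_ne_zero_of_mul hj⟩).choose) (fun _ _ _ => Finset.mem_univ _)
    (fun j _ hj j' _ hj' hjj => ?_) (fun k _ hk => ?_) (fun j _ hj => ?_)).symm
  · have h1 := (hcov j ⟨i, left_ne_zero_of_mul hj⟩).choose_spec
    have h2 := (hcov j' ⟨i, left_ne_zero_of_mul hj'⟩).choose_spec
    rw [hjj, h2] at h1
    exact (Option.some.inj h1).symm
  · cases hg : g₁ k with
    | none => simp [hg] at hk
    | some j =>
      rw [hg, Option.elim_some, hh k j hg] at hk
      exact ⟨j, Finset.mem_univ _, hk,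
        hinj _ _ j (hcov j ⟨i, left_ne_zero_of_mul hk⟩).choose_spec hg⟩
  · have h1 := (hcov j ⟨i, left_ne_zero_of_mul hj⟩).choose_spec
    rw [h1, Option.elim_some, hh _ j h1]

/-- The number of nonzero weights in one layer of a network of constant width. -/
def layerNonzero {W : ℕ} (g : Fin W → Option (Fin W) → ℝ) : ℕ :=
  ∑ r, ∑ c, if g r c ≠ 0 then 1 else 0

/-- Injectivity of the labellings prevents a weight from being copied into two slots. -/
theorem layerNonzero_relabel_le {W m n : ℕ} {g₂ : Fin W → Option (Fin n)}
    {g₁ : Fin W → Option (Fin m)} (A : Matrix (Fin n) (Fin m) ℝ) (b : Fin n → ℝ)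
    (hinj₂ : ∀ r r' j, g₂ r = some j → g₂ r' = some j → r = r')
    (hinj₁ : ∀ r r' j, g₁ r = some j → g₁ r' = some j → r = r') :
    layerNonzero (relabel g₂ g₁ A b) ≤
      Set.ncard {ij : _ × _ | A ij.1 ij.2 ≠ 0} + Set.ncard {i | b i ≠ 0} := by
  classical
  have h1 : layerNonzero (relabel g₂ g₁ A b) =
      Set.ncard {q : Fin W × Option (Fin W) | relabel g₂ g₁ A b q.1 q.2 ≠ 0} := by
    rw [Set.ncard_eq_toFinset_card', Set.toFinset_ofPred, Finset.card_filter, layerNonzero,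
      Fintype.sum_prod_type]
  have hpos : ∀ q ∈ {q : Fin W × Option (Fin W) | relabel g₂ g₁ A b q.1 q.2 ≠ 0}, 0 < W :=
    fun q _ => q.1.pos
  rw [h1]
  rcases Nat.eq_zero_or_pos W with hW | hW
  · rw [Set.eq_empty_of_forall_notMem fun q hq => (hpos q hq).ne' hW]
    simp
  -- A one-sided inverse of the labelling. Indices that no slot carries get the default slot `0`,
  -- which exists as `W` is positive.
  have hinv : ∀ {l : ℕ} (g : Fin W → Option (Fin l)),
      (∀ r r' j, g r = some j → g r' = some j → r = r') →
      ∃ e : Fin l → Fin W, ∀ r j, g r = some j → r = e j := by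
    intro l g hg
    refine ⟨fun j => if h : ∃ r, g r = some j then h.choose else ⟨0, hW⟩, fun r j hr => ?_⟩
    have h : ∃ r, g r = some j := ⟨r, hr⟩
    simp only [dif_pos h]
    exact hg _ _ j hr h.choose_spec
  obtain ⟨e₁, he₁⟩ := hinv g₁ hinj₁
  obtain ⟨e₂, he₂⟩ := hinv g₂ hinj₂
  have hsub : {q : Fin W × Option (Fin W) | relabel g₂ g₁ A b q.1 q.2 ≠ 0} ⊆
      (fun ij : Fin n × Fin m => (e₂ ij.1, some (e₁ ij.2))) '' {ij | A ij.1 ij.2 ≠ 0} ∪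
        (fun i => (e₂ i, none)) '' {i | b i ≠ 0} := by
    rintro ⟨r, c⟩ hq
    simp only [Set.mem_ofPred_eq, relabel] at hq
    cases hr : g₂ r with
    | none => simp [hr] at hq
    | some i =>
      cases c with
      | none =>
        right
        refine ⟨i, by simpa [hr] using hq, ?_⟩
        simp [← he₂ r i hr]
      | some k =>
        cases hk : g₁ k with
        | none => simp [hr, hk] at hq
        | some j =>
          left
          refine ⟨(i, j), by simpa [hr, hk] using hq, ?_⟩
          simp [← he₂ r i hr, ← he₁ k j hk]
  refine (Set.ncard_le_ncard hsub (Set.toFinite _)).trans ((Set.ncard_union_le _ _).trans ?_)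
  exact add_le_add (Set.ncard_image_le (Set.toFinite _)) (Set.ncard_image_le (Set.toFinite _))

/-- Every nonzero column contains a nonzero weight. This bounds the number of neurons that the next
layer uses, whatever the width is. -/
theorem card_columns_le {m n : ℕ} (A : Matrix (Fin n) (Fin m) ℝ) [DecidableEq (Fin m)]
    [DecidablePred fun j => ∃ i, A i j ≠ 0] :
    (Finset.univ.filter fun j => ∃ i, A i j ≠ 0).card ≤
      Set.ncard {ij : _ × _ | A ij.1 ij.2 ≠ 0} := by
  rw [← Set.ncard_coe_finset]
  refine (Set.ncard_le_ncard (t := Prod.snd '' {ij : Fin n × Fin m | A ij.1 ij.2 ≠ 0}) ?_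
    (Set.toFinite _)).trans (Set.ncard_image_le (Set.toFinite _))
  intro j hj
  obtain ⟨i, hi⟩ := (Finset.mem_filter.1 (Finset.mem_coe.1 hj)).2
  exact ⟨(i, j), hi, rfl⟩

/-- Every network is, on any selection of at most `W` of its last neurons, a network of constant
width `W`, provided that it has at most `W` nonzero weights. -/
theorem exists_weights_hidden {d W : ℕ} (ρ : ℝ → ℝ) (hd : d ≤ W) {B : ℝ} (hB : 0 ≤ B)
    {ℓ n : ℕ} (net : Net d ℓ n) (hW : net.numNonzero ≤ W) (hnB : net.WeightsBounded B)
    (J : Finset (Fin n)) (hJ : J.card ≤ W) :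
    ∃ (θ : Weights W) (g : Fin W → Option (Fin n)),
      (∀ j ∈ J, ∃ r, g r = some j) ∧ (∀ r r' j, g r = some j → g r' = some j → r = r') ∧
      (∀ x r j, g r = some j → act ρ θ x ℓ r = net.hidden ρ x j) ∧
      (∀ k r c, |θ k r c| ≤ B) ∧ ∑ k ∈ Finset.range ℓ, layerNonzero (θ k) ≤ net.numNonzero := by
  classical
  induction net with
  | input =>
    refine ⟨fun _ _ _ => 0, fun r => if h : (r : ℕ) < d then some ⟨r, h⟩ else none, ?_, ?_, ?_,
      ?_, ?_⟩
    · exact fun j _ => ⟨⟨j, j.2.trans_le hd⟩, by simp⟩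
    · intro r r' j hr hr'
      dsimp only at hr hr'
      split_ifs at hr hr' with h h'
      simp only [Option.some.injEq] at hr hr'
      exact Fin.ext (by simpa using hr.trans hr'.symm)
    · intro x r j hr
      dsimp only at hr
      split_ifs at hr with h
      simp only [Option.some.injEq] at hr
      simp [act, pad, h, Net.hidden, hr]
    · intro _ _ _
      simpa using hB
    · simp
  | @layer ℓ m n prev A b ih =>
    simp only [Net.numNonzero] at hW
    obtain ⟨hp, hA, hb⟩ := hnB
    -- The selection for the layer below consists of the nonzero columns of `A`, which fit into
    -- width `W` by sparsity. This is why the induction runs over arbitrary selections `J`.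
    obtain ⟨θ, g₁, hcov, hinj, hval, hθB, hθn⟩ := ih (by omega) hp
      (Finset.univ.filter fun j => ∃ i, A i j ≠ 0) ((card_columns_le A).trans (by omega))
    obtain ⟨g₂, hcov₂, hinj₂⟩ := exists_relabelling J hJ
    refine ⟨Function.update θ ℓ (relabel g₂ g₁ A b), g₂, hcov₂, hinj₂, fun x r i hr => ?_,
      fun k r c => ?_, ?_⟩
    · have hact : act ρ (Function.update θ ℓ (relabel g₂ g₁ A b)) x ℓ = act ρ θ x ℓ :=
        act_congr ρ x fun k hk => Function.update_of_ne hk.ne _ _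
      simp only [act, Net.hidden, hact, Function.update_self]
      rw [sum_relabel_mul hinj (fun j hj => hcov j (by simpa using hj)) (hval x) hr]
    · rcases eq_or_ne k ℓ with rfl | hk
      · rw [Function.update_self]
        exact abs_relabel_le g₂ g₁ hB hA hb r c
      · rw [Function.update_of_ne hk]
        exact hθB k r c
    · rw [Finset.sum_range_succ, Function.update_self, Finset.sum_congr rfl fun k hk => by
        rw [Function.update_of_ne (Finset.mem_range.1 hk).ne]]
      have := layerNonzero_relabel_le A b hinj₂ hinj
      simp only [Net.numNonzero]
      omega

/-- The weights of a network of constant width `W` with `m + 1` layers, at most `s` nonzero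
weights, and weights bounded by `B`. -/
structure IsSparse {W : ℕ} (m s : ℕ) (B : ℝ) (θ : Weights W) : Prop where
  bound : ∀ k r c, |θ k r c| ≤ B
  sparse : ∑ k ∈ Finset.range (m + 1), layerNonzero (θ k) ≤ s

theorem exists_weights {d : ℕ} {ρ : ℝ → ℝ} {m nD W : ℕ} {B : ℝ} (hB : 0 ≤ B) (hW : nD ≤ W)
    (hdW : d + 1 ≤ W) {f : EuclideanSpace ℝ (Fin d) → EuclideanSpace ℝ (Fin (d + 1))}
    (hf : f ∈ networkClass d ρ (m + 1) nD B) :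
    ∃ θ : Weights W, IsSparse m nD B θ ∧
      ∀ x i, f x i = ∑ c, θ m (Fin.castLE hdW i) c * c.elim 1 (act ρ θ x m) := by
  classical
  obtain ⟨net, hnz, hwb, rfl⟩ := hf
  cases net with
  | @layer _ n _ prev A b =>
    simp only [Net.numNonzero] at hnz
    obtain ⟨hp, hA, hb⟩ := hwb
    obtain ⟨θ, g₁, hcov, hinj, hval, hθB, hθn⟩ := exists_weights_hidden (W := W) ρ (by omega) hB prev
      (by omega) hp (Finset.univ.filter fun j => ∃ i, A i j ≠ 0)
      ((card_columns_le A).trans (by omega))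
    -- The output coordinates must keep their places, so the last layer uses the order-preserving
    -- labelling of all `d + 1` rows, zero rows included.
    let g₂ : Fin W → Option (Fin (d + 1)) := fun r =>
      if h : (r : ℕ) < d + 1 then some ⟨r, h⟩ else none
    have hinj₂ : ∀ r r' j, g₂ r = some j → g₂ r' = some j → r = r' := by
      intro r r' j hr hr'
      simp only [g₂] at hr hr'
      split_ifs at hr hr' with h h'
      simp only [Option.some.injEq] at hr hr'
      exact Fin.ext (by simpa using hr.trans hr'.symm)
    refine ⟨Function.update θ m (relabel g₂ g₁ A b), ⟨fun k r c => ?_, ?_⟩, fun x i => ?_⟩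
    · rcases eq_or_ne k m with rfl | hk
      · rw [Function.update_self]
        exact abs_relabel_le g₂ g₁ hB hA hb r c
      · rw [Function.update_of_ne hk]
        exact hθB k r c
    · rw [Finset.sum_range_succ, Function.update_self, Finset.sum_congr rfl fun k hk => by
        rw [Function.update_of_ne (Finset.mem_range.1 hk).ne]]
      have := layerNonzero_relabel_le A b hinj₂ hinj
      omega
    · have hact : act ρ (Function.update θ m (relabel g₂ g₁ A b)) x m = act ρ θ x m :=
        act_congr ρ x fun k hk => Function.update_of_ne hk.ne _ _
      have hr : g₂ (Fin.castLE hdW i) = some i := by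
        simp only [g₂, Fin.val_castLE]
        rw [dif_pos i.2]
      simp only [hact, Function.update_self]
      rw [sum_relabel_mul hinj (fun j hj => hcov j (by simpa using hj)) (hval x) hr]
      rfl

/-- The `ℓ¹` norm of a whole layer is controlled by sparsity alone; the width `W`, and through it
`d`, does not enter the later estimates. -/
theorem IsSparse.sum_abs_le {W m s : ℕ} {B : ℝ} {θ : Weights W} (h : IsSparse m s B θ)
    (hB : 0 ≤ B) {k : ℕ} (hk : k < m + 1) : ∑ r, ∑ c, |θ k r c| ≤ s * B := by
  have h1 : (layerNonzero (θ k) : ℝ) ≤ s := by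
    exact_mod_cast (Finset.single_le_sum (f := fun k => layerNonzero (θ k))
      (fun _ _ => Nat.zero_le _) (Finset.mem_range.2 hk)).trans h.sparse
  have h2 : ∑ r, ∑ c, |θ k r c| ≤ layerNonzero (θ k) * B := by
    rw [layerNonzero]
    push_cast
    simp only [Finset.sum_mul]
    refine Finset.sum_le_sum fun r _ => Finset.sum_le_sum fun c _ => ?_
    split_ifs with h0
    · simpa using h.bound k r c
    · simp [not_not.1 h0]
  exact h2.trans (mul_le_mul_of_nonneg_right h1 hB)

/-! ### Coding of sparse vectors -/

theorem exists_quantizer {B : ℝ} (hB : 0 < B) {G : ℕ} (hG : 1 ≤ G) :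
    ∃ q : ℝ → Fin (2 * G + 1), ∀ a a', |a| ≤ B → |a'| ≤ B → q a = q a' → |a - a'| ≤ B / G := by
  have hG0 : (0 : ℝ) < G := by exact_mod_cast hG
  -- `Fin.ofNat` reduces modulo `2G + 1`, which has no effect for `|a| ≤ B`, where the floor is at
  -- most `2G`.
  refine ⟨fun a => Fin.ofNat (2 * G + 1) ⌊(a + B) * G / B⌋₊, fun a a' ha ha' h => ?_⟩
  have key : ∀ a, |a| ≤ B → 0 ≤ (a + B) * G / B ∧ ⌊(a + B) * G / B⌋₊ < 2 * G + 1 := by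
    intro a ha
    obtain ⟨h1, h2⟩ := abs_le.1 ha
    have h0 : 0 ≤ (a + B) * G / B := by
      have : 0 ≤ a + B := by linarith
      positivity
    refine ⟨h0, ?_⟩
    rw [Nat.floor_lt h0, div_lt_iff₀ hB]
    push_cast
    nlinarith
  obtain ⟨p1, l1⟩ := key a ha
  obtain ⟨p2, l2⟩ := key a' ha'
  have h3 : ⌊(a + B) * G / B⌋₊ = ⌊(a' + B) * G / B⌋₊ := by
    have := congrArg Fin.val h
    simpa [Fin.ofNat, Nat.mod_eq_of_lt l1, Nat.mod_eq_of_lt l2] using this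
  have h4 := Nat.floor_le p1
  have h5 := Nat.lt_floor_add_one ((a + B) * G / B)
  have h6 := Nat.floor_le p2
  have h7 := Nat.lt_floor_add_one ((a' + B) * G / B)
  rw [h3] at h4 h5
  have h8 : (a + B) * G / B - (a' + B) * G / B = (a - a') * G / B := by ring
  have h9 : |(a - a') * G / B| ≤ 1 := by
    rw [← h8, abs_le]
    constructor <;> linarith
  rw [abs_div, abs_mul, abs_of_pos hG0, abs_of_pos hB, div_le_one hB] at h9
  rwa [le_div_iff₀ hG0]

/-- Vectors with at most `s` nonzero coordinates, all bounded by `B`, coded up to an `ℓ¹` error. -/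
theorem exists_sparse_code {α : Type*} [Fintype α] [Nonempty α] (s : ℕ) {B : ℝ} (hB : 0 < B)
    {G : ℕ} (hG : 1 ≤ G) :
    ∃ e : (α → ℝ) → (Fin s → α × Fin (2 * G + 1)), ∀ w w',
      (∀ q, |w q| ≤ B) → (∀ q, |w' q| ≤ B) →
      ∑ q, (if w q ≠ 0 then 1 else 0) ≤ s → ∑ q, (if w' q ≠ 0 then 1 else 0) ≤ s →
      e w = e w' → ∑ q, |w q - w' q| ≤ s * (B / G) := by
  classical
  obtain ⟨Q, hQ⟩ := exists_quantizer hB hG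
  have henum : ∀ w : α → ℝ, ∃ p : Fin s → α,
      ∑ q, (if w q ≠ 0 then 1 else 0) ≤ s → ∀ q, w q ≠ 0 → ∃ k, p k = q := by
    intro w
    let S := Finset.univ.filter fun q => w q ≠ 0
    -- The list enumerates the support; unused places are filled with an arbitrary position.
    refine ⟨fun k => if h : (k : ℕ) < S.card then S.equivFin.symm ⟨k, h⟩ else Classical.arbitrary α,
      fun hs q hq => ?_⟩
    have hS : S.card ≤ s := by rwa [Finset.card_filter]
    have hqS : q ∈ S := by simp [S, hq]
    exact ⟨⟨S.equivFin ⟨q, hqS⟩, (S.equivFin ⟨q, hqS⟩).2.trans_le hS⟩, by simp⟩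
  choose p hp using henum
  refine ⟨fun w k => (p w k, Q (w (p w k))), fun w w' hw hw' hs hs' he => ?_⟩
  have he1 : p w = p w' := funext fun k => (Prod.ext_iff.1 (congrFun he k)).1
  have he2 : ∀ k, Q (w (p w k)) = Q (w' (p w k)) := fun k => by
    have := (Prod.ext_iff.1 (congrFun he k)).2
    simp only at this
    rw [this, he1]
  -- Equal codes share one list of positions, and both vectors vanish off that list. Repeated
  -- positions only enlarge the right-hand side.
  have h1 : ∀ q, |w q - w' q| ≤ ∑ k, if p w k = q then |w q - w' q| else 0 := by
    intro q
    by_cases hq : ∃ k, p w k = q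
    · obtain ⟨k, hk⟩ := hq
      refine le_trans ?_ (Finset.single_le_sum
        (f := fun k => if p w k = q then |w q - w' q| else 0) (fun _ _ => ?_) (Finset.mem_univ k))
      · simp [hk]
      · split_ifs <;> positivity
    · have h2 : w q = 0 := by
        by_contra h; exact hq (hp w hs q h)
      have h3 : w' q = 0 := by
        by_contra h; exact hq (he1 ▸ hp w' hs' q h)
      rw [h2, h3, sub_zero, abs_zero]
      exact Finset.sum_nonneg fun _ _ => by split_ifs <;> simp
  calc ∑ q, |w q - w' q| ≤ ∑ q, ∑ k, if p w k = q then |w q - w' q| else 0 :=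
        Finset.sum_le_sum fun q _ => h1 q
    _ = ∑ k, |w (p w k) - w' (p w k)| := by
        rw [Finset.sum_comm]
        exact Finset.sum_congr rfl fun k _ => by simp
    _ ≤ ∑ _k : Fin s, B / G := Finset.sum_le_sum fun k _ => hQ _ _ (hw _) (hw' _) (he2 k)
    _ = s * (B / G) := by simp

/-! ### The network class -/

theorem norm_le_sum_abs {n : ℕ} (v : EuclideanSpace ℝ (Fin n)) : ‖v‖ ≤ ∑ i, |v i| := by
  rw [EuclideanSpace.norm_eq]
  refine Real.sqrt_le_iff.2 ⟨Finset.sum_nonneg fun _ _ => abs_nonneg _, ?_⟩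
  exact Finset.sum_sq_le_sq_sum_of_nonneg fun _ _ => abs_nonneg _

/-- Passing to the sum over all rows brings in the `ℓ¹` norm of the entire output layer and avoids a
factor `√(d + 1)`. -/
theorem norm_le_sum_of_abs_le {n W : ℕ} (h : n ≤ W) (v : EuclideanSpace ℝ (Fin n))
    {F : Fin W → ℝ} (hF : ∀ r, 0 ≤ F r) (hv : ∀ i, |v i| ≤ F (Fin.castLE h i)) :
    ‖v‖ ≤ ∑ r, F r := by
  refine (norm_le_sum_abs v).trans ((Finset.sum_le_sum fun i _ => hv i).trans ?_)
  have := Finset.sum_map Finset.univ (Fin.castLEEmb h) F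
  simp only [Fin.coe_castLEEmb] at this
  rw [← this]
  exact Finset.sum_le_univ_sum_of_nonneg hF

theorem exists_hasFDerivAt_of_weights {d W m : ℕ} {ρ ρ' : ℝ → ℝ} (hρ : IsTameActivation ρ ρ')
    {θ : Weights W} (hdW : d + 1 ≤ W)
    {f : EuclideanSpace ℝ (Fin d) → EuclideanSpace ℝ (Fin (d + 1))}
    (hf : ∀ x i, f x i = ∑ c, θ m (Fin.castLE hdW i) c * c.elim 1 (act ρ θ x m))
    (x : EuclideanSpace ℝ (Fin d)) :
    DifferentiableAt ℝ f x ∧ ∀ p i, partialDeriv p f x i =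
      ∑ c, θ m (Fin.castLE hdW i) c * c.elim 0 (tan ρ ρ' θ x (EuclideanSpace.single p 1) m) := by
  obtain ⟨u', hu', htan⟩ := exists_hasFDerivAt_act hρ θ x m
  have h1 : ∀ i, HasFDerivAt (fun y => f y i)
      (∑ c : Option (Fin W), θ m (Fin.castLE hdW i) c • c.elim 0 u') x := fun i => by
    simp only [hf]
    exact hasFDerivAt_affine _ hu'
  have hd : DifferentiableAt ℝ f x := by
    rw [differentiableAt_euclidean]
    exact fun i => (h1 i).differentiableAt
  refine ⟨hd, fun p i => ?_⟩
  have h2 := (EuclideanSpace.proj (𝕜 := ℝ) i).hasFDerivAt.comp x hd.hasFDerivAt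
  have h3 := congrArg (fun g => g (EuclideanSpace.single p 1)) (h2.unique (h1 i))
  simp only [affine_fderiv_apply, htan] at h3
  exact h3

theorem abs_single_le {d : ℕ} (p i : Fin d) :
    |(EuclideanSpace.single p (1 : ℝ) : EuclideanSpace ℝ (Fin d)) i| ≤ 1 := by
  rw [PiLp.single_apply]
  split_ifs <;> simp

theorem continuous_of_mem_networkClass {d : ℕ} {ρ ρ' : ℝ → ℝ} (hρ : IsTameActivation ρ ρ')
    {m nD : ℕ} {B : ℝ} (hB : 0 ≤ B)
    {f : EuclideanSpace ℝ (Fin d) → EuclideanSpace ℝ (Fin (d + 1))}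
    (hf : f ∈ networkClass d ρ (m + 1) nD B) : Continuous f := by
  obtain ⟨θ, -, hval⟩ := exists_weights (W := nD + (d + 1)) hB (by omega) (by omega) hf
  exact continuous_iff_continuousAt.2 fun x =>
    (exists_hasFDerivAt_of_weights hρ _ hval x).1.continuousAt

/-- The output layer contributes `nD * B`. For `m ≥ 1` the hidden tangents contribute `B (nD
B)^(m-1)`, which yields `nD^m`; for `m = 0` nothing is saved, hence the exponent `max m 1`. -/
theorem norm_le_of_mem_networkClass {d : ℕ} {ρ ρ' : ℝ → ℝ} (hρ : IsTameActivation ρ ρ')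
    {m nD : ℕ} {B : ℝ} (hB : 1 ≤ B) (hn : 1 ≤ nD)
    {f : EuclideanSpace ℝ (Fin d) → EuclideanSpace ℝ (Fin (d + 1))}
    (hf : f ∈ networkClass d ρ (m + 1) nD B) {x : EuclideanSpace ℝ (Fin d)}
    (hx : ∀ i, |x i| ≤ 1) :
    ‖f x‖ ≤ (nD : ℝ) ^ max m 1 * B ^ (m + 1) ∧
      ∀ p, ‖partialDeriv p f x‖ ≤ (nD : ℝ) ^ max m 1 * B ^ (m + 1) := by
  have hB0 : 0 ≤ B := by linarith
  have hn' : (1 : ℝ) ≤ nD := by exact_mod_cast hn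
  have hR : 1 ≤ (nD : ℝ) * B := one_le_mul_of_one_le_of_one_le hn' hB
  have hdW : d + 1 ≤ nD + (d + 1) := by omega
  obtain ⟨θ, hθ, hval⟩ := exists_weights hB0 (by omega) hdW hf
  have hsum : ∀ k < m + 1, ∑ r, ∑ c, |θ k r c| ≤ nD * B := fun k hk => hθ.sum_abs_le hB0 hk
  have hU : ∀ (U : ℝ), 0 ≤ U → ∑ r, (∑ c, |θ m r c|) * U ≤ nD * B * U := fun U hU => by
    rw [← Finset.sum_mul]
    exact mul_le_mul_of_nonneg_right (hsum m (Nat.lt_succ_self m)) hU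
  have hpow : (nD : ℝ) * B ≤ (nD : ℝ) ^ max m 1 * B ^ (m + 1) := by
    refine mul_le_mul ?_ ?_ hB0 (by positivity)
    · exact le_self_pow₀ hn' (by omega)
    · exact le_self_pow₀ hB (by omega)
  constructor
  · refine (norm_le_sum_of_abs_le hdW (f x) (F := fun r => (∑ c, |θ m r c|) * 1)
      (fun r => by positivity) fun i => ?_).trans ((hU 1 zero_le_one).trans (by simpa using hpow))
    rw [hval]
    exact abs_sum_mul_le _ _ (abs_elim_le (abs_one.le) (abs_act_le_one hρ θ hx m))
  · intro p
    have hrow : ∀ k < m, ∀ r, ∑ c, |θ k r c| ≤ nD * B := fun k hk => row_le (hsum k (by omega))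
    have key : ∀ U : ℝ, 0 ≤ U →
        (∀ r, |tan ρ ρ' θ x (EuclideanSpace.single p 1) m r| ≤ U) →
        ‖partialDeriv p f x‖ ≤ nD * B * U := fun U hU0 ht => by
      refine (norm_le_sum_of_abs_le hdW (partialDeriv p f x) (F := fun r => (∑ c, |θ m r c|) * U)
        (fun r => by positivity) fun i => ?_).trans (hU U hU0)
      rw [(exists_hasFDerivAt_of_weights hρ hdW hval x).2]
      exact abs_sum_mul_le _ _ (abs_elim_le (by simpa using hU0) ht)
    cases m with
    | zero =>
      have := key 1 zero_le_one fun r => by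
        simpa using abs_tan_le hρ hR hrow x (abs_single_le p) le_rfl r
      simpa using this
    | succ m =>
      refine (key _ (by positivity) fun r =>
        abs_tan_single_le hρ hR hB0 hrow hθ.bound x p le_rfl r).trans (le_of_eq ?_)
      rw [max_eq_left (by omega), mul_pow]
      ring

/-- The `C¹` coding of the network class. -/
theorem exists_network_code {d : ℕ} {ρ ρ' : ℝ → ℝ} (hρ : IsTameActivation ρ ρ')
    {m nD : ℕ} {B : ℝ} (hB : 1 ≤ B) (hn : 1 ≤ nD) {G : ℕ} (hG : 1 ≤ G) :
    ∃ e : networkClass d ρ (m + 1) nD B →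
        (Fin nD → (Fin (m + 1) × Fin (nD + (d + 1)) × Option (Fin (nD + (d + 1)))) ×
          Fin (2 * G + 1)),
      ∀ f f', e f = e f' → ∀ x : EuclideanSpace ℝ (Fin d), (∀ i, |x i| ≤ 1) →
        ‖f.1 x - f'.1 x‖ ≤ (2 * (nD * B)) ^ (2 * (m + 1)) * (nD * (B / G)) ∧
        ∀ p, ‖partialDeriv p f.1 x - partialDeriv p f'.1 x‖ ≤
          (2 * (nD * B)) ^ (2 * (m + 1)) * (nD * (B / G)) := by
  have hB0 : 0 < B := by linarith
  have hn' : (1 : ℝ) ≤ nD := by exact_mod_cast hn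
  set R : ℝ := nD * B with hRdef
  have hR : 1 ≤ R := one_le_mul_of_one_le_of_one_le hn' hB
  set δ : ℝ := nD * (B / G) with hδdef
  have hδ : 0 ≤ δ := by positivity
  have hdW : d + 1 ≤ nD + (d + 1) := by omega
  -- One width for the whole class: it accommodates both the `nD` possibly active neurons and the `d
  -- + 1` outputs.
  set W := nD + (d + 1) with hWdef
  have hmem : ∀ f : networkClass d ρ (m + 1) nD B, ∃ θ : Weights W, IsSparse m nD B θ ∧
      ∀ x i, f.1 x i = ∑ c, θ m (Fin.castLE hdW i) c * c.elim 1 (act ρ θ x m) :=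
    fun f => exists_weights hB0.le (by omega) hdW f.2
  choose θ hθ hval using hmem
  have : NeZero W := ⟨by omega⟩
  obtain ⟨e, he⟩ := exists_sparse_code (α := Fin (m + 1) × Fin W × Option (Fin W)) nD hB0 hG
  let w : networkClass d ρ (m + 1) nD B → Fin (m + 1) × Fin W × Option (Fin W) → ℝ :=
    fun f q => θ f q.1 q.2.1 q.2.2
  have hw1 : ∀ f q, |w f q| ≤ B := fun f q => (hθ f).bound _ _ _
  have hw2 : ∀ f, ∑ q, (if w f q ≠ 0 then 1 else 0) ≤ nD := fun f => by
    refine le_trans (le_of_eq ?_) (hθ f).sparse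
    rw [Fintype.sum_prod_type, Finset.sum_range]
    exact Finset.sum_congr rfl fun k _ => by rw [Fintype.sum_prod_type]; rfl
  refine ⟨fun f => e (w f), fun f f' hff x hx => ?_⟩
  have hsum := he _ _ (hw1 f) (hw1 f') (hw2 f) (hw2 f') hff
  have hclose : CloseWeights (m + 1) R δ (θ f) (θ f') := by
    refine ⟨fun k hk => (hθ f).sum_abs_le hB0.le hk, fun k hk => (hθ f').sum_abs_le hB0.le hk,
      fun k hk => le_trans ?_ hsum⟩
    rw [Fintype.sum_prod_type]
    refine le_trans ?_ (Finset.single_le_sum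
      (f := fun k : Fin (m + 1) => ∑ q : Fin W × Option (Fin W), |w f (k, q) - w f' (k, q)|)
      (fun _ _ => Finset.sum_nonneg fun _ _ => abs_nonneg _) (Finset.mem_univ ⟨k, hk⟩))
    rw [Fintype.sum_prod_type]
  have hm : m < m + 1 := Nat.lt_succ_self m
  have hfin : ∀ e U : ℝ, 0 ≤ e → 0 ≤ U →
      ∑ r, ((∑ c, |θ f m r c|) * e + (∑ c, |θ f m r c - θ f' m r c|) * U) ≤ R * e + δ * U := by
    intro e U he hU
    rw [Finset.sum_add_distrib, ← Finset.sum_mul, ← Finset.sum_mul]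
    have := hclose.left m hm
    have := hclose.sub m hm
    gcongr
  have hy : (1 : ℝ) ≤ 2 * R := by linarith
  constructor
  · have hpos : 0 ≤ (2 * R) ^ m * δ := by positivity
    refine (norm_le_sum_of_abs_le hdW _ (F := fun r => (∑ c, |θ f m r c|) * ((2 * R) ^ m * δ) +
      (∑ c, |θ f m r c - θ f' m r c|) * 1) (fun r => by positivity) fun i => ?_).trans
      ((hfin _ 1 hpos zero_le_one).trans ?_)
    · rw [PiLp.sub_apply, hval, hval, mul_one]
      exact abs_preact_sub_le hρ hR hδ hclose hx hm.le _
    · have h3 : (1 : ℝ) ≤ (2 * R) ^ m := one_le_pow₀ hy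
      have h4 : δ ≤ R * ((2 * R) ^ m * δ) := by
        calc δ = 1 * (1 * δ) := by ring
          _ ≤ R * ((2 * R) ^ m * δ) := by gcongr
      calc R * ((2 * R) ^ m * δ) + δ * 1 ≤ (2 * R) ^ (m + 1) * δ := by rw [pow_succ]; linarith
        _ ≤ (2 * R) ^ (2 * (m + 1)) * δ := by
          gcongr
          omega
  · intro p
    have hpos : 0 ≤ (2 * R) ^ (2 * m) * δ := by positivity
    have hRm : 0 ≤ R ^ m := by positivity
    refine (norm_le_sum_of_abs_le hdW _ (F := fun r =>
      (∑ c, |θ f m r c|) * ((2 * R) ^ (2 * m) * δ) +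
      (∑ c, |θ f m r c - θ f' m r c|) * R ^ m) (fun r => by positivity) fun i => ?_).trans
      ((hfin _ _ hpos hRm).trans ?_)
    · rw [PiLp.sub_apply, (exists_hasFDerivAt_of_weights hρ hdW (hval f) x).2,
        (exists_hasFDerivAt_of_weights hρ hdW (hval f') x).2]
      exact abs_sum_mul_sub_sum_mul_le _ _ _ _
        (abs_elim_sub_elim_le hpos
          (abs_tan_sub_le hρ hR hδ hclose hx (abs_single_le p) hm.le))
        (abs_elim_le (by simpa using hRm) (abs_tan_le hρ hR
          (fun k hk => row_le (hclose.right k hk)) x (abs_single_le p) hm.le))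
    · have h3 : R ^ m ≤ R * (2 * R) ^ (2 * m) := by
        calc R ^ m ≤ (2 * R) ^ m := pow_le_pow_left₀ (by linarith) (by linarith) m
          _ ≤ (2 * R) ^ (2 * m) := pow_le_pow_right₀ hy (by omega)
          _ ≤ R * (2 * R) ^ (2 * m) := le_mul_of_one_le_left (by positivity) hR
      calc R * ((2 * R) ^ (2 * m) * δ) + δ * R ^ m
          ≤ R * ((2 * R) ^ (2 * m) * δ) + δ * (R * (2 * R) ^ (2 * m)) := by gcongr
        _ = (2 * R) ^ (2 * m + 1) * δ := by ring
        _ ≤ (2 * R) ^ (2 * (m + 1)) * δ := by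
          gcongr
          omega

/-! ### The loss density -/

theorem abs_apply_le_of_norm_le {n : ℕ} {v : EuclideanSpace ℝ (Fin n)} {K : ℝ} (h : ‖v‖ ≤ K)
    (i : Fin n) : |v i| ≤ K :=
  (PiLp.norm_apply_le v i).trans h

theorem abs_sum_le_of_abs_le {d : ℕ} {a : Fin d → ℝ} {K : ℝ} (h : ∀ i, |a i| ≤ K) :
    |∑ i, a i| ≤ d * K := by
  refine (Finset.abs_sum_le_sum_abs _ _).trans ((Finset.sum_le_sum fun i _ => h i).trans ?_)
  simp

section Pointwise

variable {d : ℕ} {ω f : EuclideanSpace ℝ (Fin d) → ℝ}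
  {F F' : EuclideanSpace ℝ (Fin d) → EuclideanSpace ℝ (Fin (d + 1))}
  {x : EuclideanSpace ℝ (Fin d)} {M K η : ℝ}

theorem abs_flux_residual_le (hF : ‖F x‖ ≤ K) (hF' : ∀ p, ‖partialDeriv p F x‖ ≤ K) (i : Fin d) :
    |F x i.succ - partialDeriv i F x 0| ≤ 2 * K := by
  have h1 := abs_apply_le_of_norm_le hF i.succ
  have h2 := abs_apply_le_of_norm_le (hF' i) 0
  refine (abs_sub _ _).trans ?_
  linarith

theorem abs_balance_residual_le (hd : 1 ≤ d) (hM : 0 ≤ M) (hω : |ω x| ≤ M) (hf : |f x| ≤ M)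
    (hK : 1 ≤ K) (hF : ‖F x‖ ≤ K) (hF' : ∀ p, ‖partialDeriv p F x‖ ≤ K) :
    |-(∑ i : Fin d, partialDeriv i F x i.succ) + ω x * F x 0 - f x| ≤ d * (1 + 2 * M) * K := by
  have hd' : (1 : ℝ) ≤ d := by exact_mod_cast hd
  have h1 := abs_sum_le_of_abs_le fun i : Fin d => abs_apply_le_of_norm_le (hF' i) i.succ
  have h2 : |ω x * F x 0| ≤ M * K := by
    rw [abs_mul]
    exact mul_le_mul hω (abs_apply_le_of_norm_le hF 0) (abs_nonneg _) hM
  have h3 : M ≤ d * M * K := by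
    calc M = 1 * M * 1 := by ring
      _ ≤ d * M * K := by gcongr
  have h4 : M * K ≤ d * (M * K) := le_mul_of_one_le_left (by positivity) hd'
  rw [abs_le] at *
  constructor <;> nlinarith

/-- The factor `d²` comes from the square of the divergence, a sum of `d` terms; the flux term is
only of order `d`. -/
theorem abs_lossDensity_le (hd : 1 ≤ d) (hM : 0 ≤ M) (hω : |ω x| ≤ M) (hf : |f x| ≤ M)
    (hK : 1 ≤ K) (hF : ‖F x‖ ≤ K) (hF' : ∀ p, ‖partialDeriv p F x‖ ≤ K) :
    |lossDensity ω f F x| ≤ 4 * (1 + M) ^ 2 * d ^ 2 * K ^ 2 := by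
  have hd' : (1 : ℝ) ≤ d := by exact_mod_cast hd
  have h1 : |∑ i : Fin d, (F x i.succ - partialDeriv i F x 0) ^ 2| ≤ d * (2 * K) ^ 2 :=
    abs_sum_le_of_abs_le fun i => by
      rw [abs_pow]
      exact pow_le_pow_left₀ (abs_nonneg _) (abs_flux_residual_le hF hF' i) 2
  have h2 : |(-(∑ i : Fin d, partialDeriv i F x i.succ) + ω x * F x 0 - f x) ^ 2| ≤
      (d * (1 + 2 * M) * K) ^ 2 := by
    rw [abs_pow]
    exact pow_le_pow_left₀ (abs_nonneg _) (abs_balance_residual_le hd hM hω hf hK hF hF') 2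
  have h3 : |ω x * ∑ i : Fin d, (F x i.succ - partialDeriv i F x 0) ^ 2| ≤
      M * (d * (2 * K) ^ 2) := by
    rw [abs_mul]
    exact mul_le_mul hω h1 (abs_nonneg _) hM
  refine (abs_add_le _ _).trans ((add_le_add h3 h2).trans ?_)
  have h4 : (d : ℝ) ≤ d ^ 2 := le_self_pow₀ hd' two_ne_zero
  calc M * (d * (2 * K) ^ 2) + (d * (1 + 2 * M) * K) ^ 2
      ≤ M * (d ^ 2 * (2 * K) ^ 2) + (d * (1 + 2 * M) * K) ^ 2 := by gcongr
    _ = (1 + 8 * M + 4 * M ^ 2) * (d ^ 2 * K ^ 2) := by ring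
    _ ≤ (4 * (1 + M) ^ 2) * (d ^ 2 * K ^ 2) := by gcongr; nlinarith
    _ = _ := by ring

theorem abs_sq_sub_sq_le {a b p q : ℝ} (h : |a - b| ≤ p) (ha : |a| ≤ q) (hb : |b| ≤ q) :
    |a ^ 2 - b ^ 2| ≤ p * (2 * q) := by
  have h1 : a ^ 2 - b ^ 2 = (a - b) * (a + b) := by ring
  rw [h1, abs_mul]
  refine mul_le_mul h ((abs_add_le _ _).trans (by linarith)) (abs_nonneg _)
    ((abs_nonneg _).trans h)

/-- Each squared residual is treated as a difference of two squares: one factor is of order `η`, the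
other of order `K`. -/
theorem abs_lossDensity_sub_le (hd : 1 ≤ d) (hM : 0 ≤ M) (hω : |ω x| ≤ M) (hf : |f x| ≤ M)
    (hK : 1 ≤ K) (hF1 : ‖F x‖ ≤ K) (hF2 : ∀ p, ‖partialDeriv p F x‖ ≤ K)
    (hF1' : ‖F' x‖ ≤ K) (hF2' : ∀ p, ‖partialDeriv p F' x‖ ≤ K) (hη : 0 ≤ η)
    (hsub : ‖F x - F' x‖ ≤ η) (hsub' : ∀ p, ‖partialDeriv p F x - partialDeriv p F' x‖ ≤ η) :
    |lossDensity ω f F x - lossDensity ω f F' x| ≤ 8 * (1 + M) ^ 2 * d ^ 2 * K * η := by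
  have hd' : (1 : ℝ) ≤ d := by exact_mod_cast hd
  have e1 : ∀ j, |F x j - F' x j| ≤ η := fun j => by
    simpa using abs_apply_le_of_norm_le hsub j
  have e2 : ∀ p j, |partialDeriv p F x j - partialDeriv p F' x j| ≤ η := fun p j => by
    simpa using abs_apply_le_of_norm_le (hsub' p) j
  have h1 : |∑ i : Fin d, ((F x i.succ - partialDeriv i F x 0) ^ 2 -
      (F' x i.succ - partialDeriv i F' x 0) ^ 2)| ≤ d * ((2 * η) * (2 * (2 * K))) :=
    abs_sum_le_of_abs_le fun i => by
      refine abs_sq_sub_sq_le ?_ (abs_flux_residual_le hF1 hF2 i)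
        (abs_flux_residual_le hF1' hF2' i)
      have h3 := e1 i.succ
      have h4 := e2 i 0
      rw [abs_le] at *
      constructor <;> linarith
  have h2 : |ω x * ∑ i : Fin d, ((F x i.succ - partialDeriv i F x 0) ^ 2 -
      (F' x i.succ - partialDeriv i F' x 0) ^ 2)| ≤ M * (d * ((2 * η) * (2 * (2 * K)))) := by
    rw [abs_mul]
    exact mul_le_mul hω h1 (abs_nonneg _) hM
  have h3 : |(-(∑ i : Fin d, partialDeriv i F x i.succ) + ω x * F x 0 - f x) ^ 2 -
      (-(∑ i : Fin d, partialDeriv i F' x i.succ) + ω x * F' x 0 - f x) ^ 2| ≤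
      (d * (1 + M) * η) * (2 * (d * (1 + 2 * M) * K)) := by
    refine abs_sq_sub_sq_le ?_ (abs_balance_residual_le hd hM hω hf hK hF1 hF2)
      (abs_balance_residual_le hd hM hω hf hK hF1' hF2')
    have h4 : |∑ i : Fin d, (partialDeriv i F x i.succ - partialDeriv i F' x i.succ)| ≤ d * η :=
      abs_sum_le_of_abs_le fun i => e2 i i.succ
    have h5 : |ω x * (F x 0 - F' x 0)| ≤ M * η := by
      rw [abs_mul]
      exact mul_le_mul hω (e1 0) (abs_nonneg _) hM
    have h6 : M * η ≤ d * (M * η) := le_mul_of_one_le_left (by positivity) hd'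
    rw [Finset.sum_sub_distrib] at h4
    rw [abs_le] at *
    constructor <;> nlinarith
  have h7 : lossDensity ω f F x - lossDensity ω f F' x =
      ω x * ∑ i : Fin d, ((F x i.succ - partialDeriv i F x 0) ^ 2 -
        (F' x i.succ - partialDeriv i F' x 0) ^ 2) +
      ((-(∑ i : Fin d, partialDeriv i F x i.succ) + ω x * F x 0 - f x) ^ 2 -
        (-(∑ i : Fin d, partialDeriv i F' x i.succ) + ω x * F' x 0 - f x) ^ 2) := by
    rw [Finset.sum_sub_distrib, lossDensity, lossDensity]
    ring
  rw [h7]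
  refine (abs_add_le _ _).trans ((add_le_add h2 h3).trans ?_)
  have h4 : (d : ℝ) ≤ d ^ 2 := le_self_pow₀ hd' two_ne_zero
  have hK0 : 0 ≤ K := by linarith
  calc M * (d * ((2 * η) * (2 * (2 * K)))) + (d * (1 + M) * η) * (2 * (d * (1 + 2 * M) * K))
      ≤ M * (d ^ 2 * ((2 * η) * (2 * (2 * K)))) +
        (d * (1 + M) * η) * (2 * (d * (1 + 2 * M) * K)) := by gcongr
    _ = (2 + 14 * M + 4 * M ^ 2) * (d ^ 2 * K * η) := by ring
    _ ≤ (8 * (1 + M) ^ 2) * (d ^ 2 * K * η) := by gcongr; nlinarith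
    _ = _ := by ring

end Pointwise

theorem aestronglyMeasurable_lossDensity {d : ℕ} {μ : Measure (EuclideanSpace ℝ (Fin d))}
    {ω f : EuclideanSpace ℝ (Fin d) → ℝ} (hω : AEStronglyMeasurable ω μ)
    (hf : AEStronglyMeasurable f μ)
    {F : EuclideanSpace ℝ (Fin d) → EuclideanSpace ℝ (Fin (d + 1))}
    (hF : AEStronglyMeasurable F μ) : AEStronglyMeasurable (lossDensity ω f F) μ := by
  have h1 : ∀ j, AEMeasurable (fun x => F x j) μ := fun j =>
    (EuclideanSpace.proj (𝕜 := ℝ) j).continuous.measurable.comp_aemeasurable hF.aemeasurable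
  -- The derivative of an arbitrary map is measurable, with value `0` where the map is not
  -- differentiable.
  have h2 : ∀ p j, Measurable fun x => partialDeriv p F x j := fun p j =>
    (EuclideanSpace.proj (𝕜 := ℝ) j).continuous.measurable.comp
      (measurable_fderiv_apply_const ℝ F (EuclideanSpace.single p 1))
  have h3 := hω.aemeasurable
  have h4 := hf.aemeasurable
  have key : ∀ (P Q S : Fin d → EuclideanSpace ℝ (Fin d) → ℝ) (u : EuclideanSpace ℝ (Fin d) → ℝ),
      (∀ i, AEMeasurable (P i) μ) → (∀ i, Measurable (Q i)) → (∀ i, Measurable (S i)) →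
      AEMeasurable u μ → AEMeasurable (fun x => ω x * ∑ i, (P i x - Q i x) ^ 2 +
        (-(∑ i, S i x) + ω x * u x - f x) ^ 2) μ := by
    intro P Q S u hP hQ hS hu
    refine (h3.mul (Finset.aemeasurable_fun_sum _ fun i _ =>
      ((hP i).sub (hQ i).aemeasurable).pow_const 2)).add (AEMeasurable.pow_const ?_ 2)
    exact (((Finset.aemeasurable_fun_sum _ fun i _ => (hS i).aemeasurable).neg).add
      (h3.mul hu)).sub h4
  exact (key (fun i x => F x i.succ) (fun i x => partialDeriv i F x 0)
    (fun i x => partialDeriv i F x i.succ) (fun x => F x 0) (fun i => h1 _) (fun i => h2 _ _)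
    (fun i => h2 _ _) (h1 0)).aestronglyMeasurable

/-! ### Counting the codes and the statistical error -/

theorem volume_le_one {d : ℕ} {Ω : Set (EuclideanSpace ℝ (Fin d))}
    (hΩ : ∀ x ∈ Ω, ∀ i, 0 ≤ x i ∧ x i ≤ 1) : volume Ω ≤ 1 := by
  have h1 : Ω ⊆ (WithLp.ofLp : EuclideanSpace ℝ (Fin d) → _) ⁻¹' Set.Icc 0 1 := fun x hx =>
    ⟨fun i => (hΩ x hx i).1, fun i => (hΩ x hx i).2⟩
  refine (measure_mono h1).trans ?_
  rw [(PiLp.volume_preserving_ofLp (Fin d)).measure_preimage measurableSet_Icc.nullMeasurableSet,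
    Real.volume_Icc_pi]
  simp

/-- The logarithm of the number of code words is of the order of the number of weights times the
depth. -/
theorem code_card_le {d D s N : ℕ} {B : ℝ} (hd : 1 ≤ d) (hD : 1 ≤ D) (hs : 1 ≤ s) (hN : 1 ≤ N)
    (hB : 1 ≤ B) {Λ : ℝ} (hΛ : Λ = (d : ℝ) * D * s * B * N) (hΛ2 : 2 ≤ Λ) {G : ℕ}
    (hG : (G : ℝ) ≤ N * (2 * (s * B)) ^ (2 * D) * (s * B) + 1) :
    (D : ℝ) * ((s + (d + 1)) * (s + (d + 1) + 1)) * (2 * G + 1) ≤ Λ ^ (16 * D) := by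
  have hd' : (1 : ℝ) ≤ d := by exact_mod_cast hd
  have hD' : (1 : ℝ) ≤ D := by exact_mod_cast hD
  have hs' : (1 : ℝ) ≤ s := by exact_mod_cast hs
  have hN' : (1 : ℝ) ≤ N := by exact_mod_cast hN
  have h1 : (D : ℝ) ≤ Λ := by
    calc (D : ℝ) = 1 * D * 1 * 1 * 1 := by ring
      _ ≤ d * D * s * B * N := by gcongr
      _ = Λ := hΛ.symm
  have h2 : (s : ℝ) * B ≤ Λ := by
    calc (s : ℝ) * B = 1 * 1 * s * B * 1 := by ring
      _ ≤ d * D * s * B * N := by gcongr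
      _ = Λ := hΛ.symm
  have h3 : (s : ℝ) ≤ Λ := (le_mul_of_one_le_right (by linarith) hB).trans h2
  have h4 : (N : ℝ) ≤ Λ := by
    calc (N : ℝ) = 1 * 1 * 1 * 1 * N := by ring
      _ ≤ d * D * s * B * N := by gcongr
      _ = Λ := hΛ.symm
  have h5 : (d : ℝ) ≤ Λ := by
    calc (d : ℝ) = d * 1 * 1 * 1 * 1 := by ring
      _ ≤ d * D * s * B * N := by gcongr
      _ = Λ := hΛ.symm
  have hΛ0 : 0 ≤ Λ := by linarith
  have h6 : (s : ℝ) + (d + 1) ≤ Λ ^ 3 := by nlinarith [mul_nonneg hΛ0 (by nlinarith : 0 ≤ Λ ^ 2 - 4)]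
  have h7 : (s : ℝ) + (d + 1) + 1 ≤ Λ ^ 3 := by
    nlinarith [mul_nonneg hΛ0 (by nlinarith : 0 ≤ Λ ^ 2 - 4)]
  have h8 : 2 * ((s : ℝ) * B) ≤ Λ ^ 2 := by nlinarith
  have h9 : (2 * ((s : ℝ) * B)) ^ (2 * D) ≤ Λ ^ (4 * D) := by
    calc (2 * ((s : ℝ) * B)) ^ (2 * D) ≤ (Λ ^ 2) ^ (2 * D) := by gcongr
      _ = Λ ^ (4 * D) := by rw [← pow_mul]; ring_nf
  have h10 : (2 * G + 1 : ℝ) ≤ Λ ^ (4 * D + 4) := by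
    have h11 : (N : ℝ) * (2 * (s * B)) ^ (2 * D) * (s * B) ≤ Λ * Λ ^ (4 * D) * Λ := by gcongr
    have h12 : (1 : ℝ) ≤ Λ ^ (4 * D) := one_le_pow₀ (by linarith)
    have h13 : Λ ^ (4 * D + 4) = Λ ^ (4 * D) * Λ ^ 4 := pow_add _ _ _
    have h14 : Λ * Λ ^ (4 * D) * Λ = Λ ^ (4 * D) * Λ ^ 2 := by ring
    rw [h13]
    rw [h14] at h11
    have h15 : 4 ≤ Λ ^ 2 := by nlinarith
    have h16 : Λ ^ 4 = Λ ^ 2 * Λ ^ 2 := by ring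
    have h17 : 2 * Λ ^ 2 + 3 ≤ Λ ^ 4 := by nlinarith
    nlinarith
  -- Every parameter is at most `Λ`, and `Λ ≥ 2` turns numerical constants into powers of `Λ`. The
  -- last step uses `4D + 11 ≤ 16D`, valid for `D ≥ 1`.
  calc (D : ℝ) * ((s + (d + 1)) * (s + (d + 1) + 1)) * (2 * G + 1)
      ≤ Λ * (Λ ^ 3 * Λ ^ 3) * Λ ^ (4 * D + 4) := by gcongr
    _ = Λ ^ (4 * D + 11) := by ring
    _ ≤ Λ ^ (16 * D) := pow_le_pow_right₀ (by linarith) (by omega)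

theorem ae_abs_le_of_eLpNorm_top_le {α : Type*} [MeasurableSpace α] {μ : Measure α} {g : α → ℝ}
    {M : ℝ} (hM : 0 ≤ M) (h : eLpNorm g ⊤ μ ≤ ENNReal.ofReal M) : ∀ᵐ x ∂μ, |g x| ≤ M := by
  rw [eLpNorm_exponent_top] at h
  filter_upwards [ae_le_eLpNormEssSup (f := g) (μ := μ)] with x hx
  have h1 := hx.trans h
  rw [← ofReal_norm, ENNReal.ofReal_le_ofReal_iff hM] at h1
  exact h1

/-- The volume of `Ω` moves into the scaling factor, so that the integral is taken against the
uniform probability measure. -/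
theorem deviations_eq_range {d N : ℕ} {Ω : Set (EuclideanSpace ℝ (Fin d))} (h0 : volume Ω ≠ 0)
    (h1 : volume Ω ≠ ⊤) (ω f : EuclideanSpace ℝ (Fin d) → ℝ)
    (φ : EuclideanSpace ℝ (Fin d) → EuclideanSpace ℝ (Fin (d + 1)) →
      EuclideanSpace ℝ (Fin (d + 1)))
    (𝒩 : Set (EuclideanSpace ℝ (Fin d) → EuclideanSpace ℝ (Fin (d + 1)))) (s : ℝ)
    (X : Fin N → EuclideanSpace ℝ (Fin d)) :
    deviations Ω ω f (addModLayer φ '' 𝒩) s X =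
      Set.range fun g : 𝒩 => meanDeviation (cond volume Ω) N (s * (volume Ω).toReal)
        (lossDensity ω f (addModLayer φ g.1)) X := by
  have hv : (volume Ω).toReal ≠ 0 := (ENNReal.toReal_pos h0 h1).ne'
  rw [deviations, Set.image_image, Set.image_eq_range]
  congr 1
  funext g
  simp only [loss, empiricalLoss, meanDeviation, ProbabilityTheory.cond, integral_smul_measure, ENNReal.toReal_inv,
    smul_eq_mul]
  field_simp

/-- The constant is `56 = 32 + 24`: the rounding error uses `A ≤ A²`, `1 / N ≤ 1 / √N` and `1 ≤
2√T`, the maximal inequality uses `√32 ≤ 6`. -/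
theorem two_mul_add_rate_le {q d A N T : ℝ} (hq : 0 ≤ q) (hA : 1 ≤ A) (hN : 1 ≤ N)
    (hT : 1 / 2 ≤ T) :
    2 * (8 * q * d ^ 2 * A * (1 / N)) + 4 * q * d ^ 2 * A ^ 2 / √N * √(2 * (16 * T)) ≤
      56 * q * (d ^ 2 * A ^ 2 * √T / √N) := by
  have hN0 : 0 < N := by linarith
  have hsN : 0 < √N := Real.sqrt_pos.2 hN0
  have hsN' : 1 / N ≤ 1 / √N := by
    apply one_div_le_one_div_of_le hsN
    rw [Real.sqrt_le_left (by linarith)]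
    nlinarith
  have hsT : 1 / 2 ≤ √T := Real.le_sqrt_of_sq_le (by linarith)
  have h1 : √(2 * (16 * T)) ≤ 6 * √T := by
    rw [show 2 * (16 * T) = 32 * T by ring, Real.sqrt_mul (by norm_num)]
    gcongr
    rw [Real.sqrt_le_left (by norm_num)]
    norm_num
  have h2 : 2 * (8 * q * d ^ 2 * A * (1 / N)) ≤ 32 * q * (d ^ 2 * A ^ 2 * √T / √N) := by
    have hAA : A ≤ A ^ 2 := le_self_pow₀ hA two_ne_zero
    calc 2 * (8 * q * d ^ 2 * A * (1 / N)) = 16 * q * d ^ 2 * A * (1 / N) * 1 := by ring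
      _ ≤ 16 * q * d ^ 2 * A ^ 2 * (1 / √N) * (2 * √T) := by
        gcongr
        linarith
      _ = _ := by ring
  have h3 : 4 * q * d ^ 2 * A ^ 2 / √N * √(2 * (16 * T)) ≤
      24 * q * (d ^ 2 * A ^ 2 * √T / √N) := by
    calc 4 * q * d ^ 2 * A ^ 2 / √N * √(2 * (16 * T))
        ≤ 4 * q * d ^ 2 * A ^ 2 / √N * (6 * √T) := by gcongr
      _ = _ := by ring
  linarith

/-- The statistical error for networks of depth `m + 1`, with a constant depending on `M`, `Bg`,
`Bg'`, `Bφ'` only. -/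
theorem statisticalErrorLE_modifiedClass {d : ℕ} (hd : 1 ≤ d) {Ω : Set (EuclideanSpace ℝ (Fin d))}
    (hΩo : IsOpen Ω) (hΩn : Ω.Nonempty) (hΩ : ∀ x ∈ Ω, ∀ i, 0 ≤ x i ∧ x i ≤ 1)
    {ω f : EuclideanSpace ℝ (Fin d) → ℝ}
    (hωm : AEStronglyMeasurable ω (volume.restrict Ω))
    (hfm : AEStronglyMeasurable f (volume.restrict Ω)) {M : ℝ} (hM : 0 ≤ M)
    (hω : ∀ᵐ x ∂volume.restrict Ω, |ω x| ≤ M) (hf : ∀ᵐ x ∂volume.restrict Ω, |f x| ≤ M)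
    {Bg Bg' Bφ' : ℝ} {ρ ρ' : ℝ → ℝ} (hρ : IsTameActivation ρ ρ') {m nD N : ℕ} {B : ℝ}
    (hn : 1 ≤ nD) (hN : 1 ≤ N) (hB : 1 ≤ B) {Λ : ℝ}
    (hΛ : Λ = (d : ℝ) * (m + 1 : ℕ) * nD * B * N) (hΛ2 : 2 ≤ Λ)
    {φ : EuclideanSpace ℝ (Fin d) → EuclideanSpace ℝ (Fin (d + 1)) →
      EuclideanSpace ℝ (Fin (d + 1))}
    (hφ : IsModificationLayer Ω (networkClass d ρ (m + 1) nD B) φ Bg Bg' Bφ') :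
    StatisticalErrorLE Ω ω f (modifiedClass d φ ρ (m + 1) nD B) N
      (56 * ((1 + M) ^ 2 * (1 + |Bg| + |Bg'| + |Bφ'|) ^ 2) *
        ((d : ℝ) ^ 2 * ((nD : ℝ) ^ max m 1 * B ^ (m + 1)) ^ 2 *
          √((m + 1 : ℕ) * nD * Real.log Λ) / √N)) := by
  have hN0 : (0 : ℝ) < N := by exact_mod_cast hN
  have hN1 : (1 : ℝ) ≤ N := by exact_mod_cast hN
  have hn1 : (1 : ℝ) ≤ nD := by exact_mod_cast hn
  have hd1 : (1 : ℝ) ≤ d := by exact_mod_cast hd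
  have hD1 : (1 : ℝ) ≤ (m + 1 : ℕ) := by exact_mod_cast Nat.succ_le_succ (Nat.zero_le m)
  have hvol0 : volume Ω ≠ 0 := (hΩo.measure_pos volume hΩn).ne'
  have hvol1 := volume_le_one hΩ
  have hvolt : volume Ω ≠ ⊤ := (hvol1.trans_lt ENNReal.one_lt_top).ne
  have : IsProbabilityMeasure (cond volume Ω) := cond_isProbabilityMeasure_of_finite hvol0 hvolt
  have hcube : ∀ x ∈ Ω, ∀ i, |x i| ≤ 1 := fun x hx i =>
    abs_le.2 ⟨by linarith [(hΩ x hx i).1], (hΩ x hx i).2⟩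
  set c := 1 + |Bg| + |Bg'| + |Bφ'| with hc
  have hc1 : 1 ≤ c := by
    rw [hc]; linarith [abs_nonneg Bg, abs_nonneg Bg', abs_nonneg Bφ']
  set A := (nD : ℝ) ^ max m 1 * B ^ (m + 1) with hA
  have hA1 : 1 ≤ A := one_le_mul_of_one_le_of_one_le (one_le_pow₀ hn1) (one_le_pow₀ hB)
  have hK : 1 ≤ c * A := one_le_mul_of_one_le_of_one_le hc1 hA1
  let 𝒩 := networkClass d ρ (m + 1) nD B
  -- The null set where the data exceed `M` is removed once for the whole, possibly uncountable,
  -- class.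
  let S : Set (EuclideanSpace ℝ (Fin d)) := {x | x ∈ Ω ∧ |ω x| ≤ M ∧ |f x| ≤ M}
  have hSr : ∀ᵐ x ∂volume.restrict Ω, x ∈ S := by
    filter_upwards [hω, hf, ae_restrict_mem hΩo.measurableSet] with x h1 h2 h3
    exact ⟨h3, h1, h2⟩
  have hS : ∀ᵐ x ∂cond volume Ω, x ∈ S := Measure.ae_smul_measure hSr _
  let Γ : 𝒩 → EuclideanSpace ℝ (Fin d) → ℝ := fun g => lossDensity ω f (addModLayer φ g.1)
  have hΓm : ∀ g, AEStronglyMeasurable (Γ g) (volume.restrict Ω) := by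
    intro g
    refine aestronglyMeasurable_lossDensity hωm hfm (ContinuousOn.aestronglyMeasurable ?_
      hΩo.measurableSet)
    have hg : Continuous g.1 := continuous_of_mem_networkClass hρ (by linarith) g.2
    exact hφ.contDiffOn.continuousOn.comp (f := fun x => (x, g.1 x))
      (continuous_id.prodMk hg).continuousOn fun x hx => ⟨hx, Set.mem_univ _⟩
  have hF : ∀ (g : 𝒩), ∀ x ∈ Ω, ‖addModLayer φ g.1 x‖ ≤ c * A ∧
      ∀ p, ‖partialDeriv p (addModLayer φ g.1) x‖ ≤ c * A := by
    intro g x hx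
    obtain ⟨h1, h2⟩ := norm_le_of_mem_networkClass hρ hB hn g.2 (hcube x hx)
    have hBg : Bg ≤ |Bg| * A := (le_abs_self _).trans (le_mul_of_one_le_right (abs_nonneg _) hA1)
    have hBg' : Bg' ≤ |Bg'| * A :=
      (le_abs_self _).trans (le_mul_of_one_le_right (abs_nonneg _) hA1)
    have hBφ : Bφ' * ‖g.1 x‖ ≤ |Bφ'| * A :=
      mul_le_mul (le_abs_self _) h1 (norm_nonneg _) (abs_nonneg _)
    have p1 : 0 ≤ |Bg| * A := by positivity
    have p2 : 0 ≤ |Bg'| * A := by positivity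
    have p3 : 0 ≤ |Bφ'| * A := by positivity
    have hcA : c * A = A + |Bg| * A + |Bg'| * A + |Bφ'| * A := by rw [hc]; ring
    refine ⟨(hφ.bound g.1 g.2 x hx).trans ?_, fun p =>
      (hφ.bound_deriv g.1 g.2 x hx p).trans ?_⟩
    · linarith
    · linarith [h2 p]
  set b := 4 * (1 + M) ^ 2 * d ^ 2 * (c * A) ^ 2 with hb
  have hb0 : 0 < b := by positivity
  have hΓb : ∀ g, ∀ x ∈ S, |Γ g x| ≤ b := fun g x hx =>
    abs_lossDensity_le hd hM hx.2.1 hx.2.2 hK (hF g x hx.1).1 (hF g x hx.1).2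
  set E := (2 * ((nD : ℝ) * B)) ^ (2 * (m + 1)) * (nD * B) with hE
  have hE0 : 0 < E := by positivity
  set q := (1 + M) ^ 2 * c ^ 2 with hq
  have hq0 : 0 < q := by positivity
  have hcode : ∀ G : ℕ, 1 ≤ G → ∃ e : 𝒩 → (Fin nD → (Fin (m + 1) × Fin (nD + (d + 1)) ×
      Option (Fin (nD + (d + 1)))) × Fin (2 * G + 1)),
      ∀ g g', e g = e g' → ∀ x ∈ S, |Γ g x - Γ g' x| ≤ 8 * q * d ^ 2 * A * (E / G) := by
    intro G hG
    obtain ⟨e, he⟩ := exists_network_code hρ hB hn hG (d := d) (m := m)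
    refine ⟨e, fun g g' hgg x hx => ?_⟩
    obtain ⟨h1, h2⟩ := he g g' hgg x (hcube x hx.1)
    have h3 : (2 * ((nD : ℝ) * B)) ^ (2 * (m + 1)) * (nD * (B / G)) = E / G := by
      rw [hE]; ring
    rw [h3] at h1 h2
    have hEG : 0 ≤ E / G := by positivity
    have hη : E / G ≤ c * (E / G) := le_mul_of_one_le_left hEG hc1
    have h4 : ‖addModLayer φ g.1 x - addModLayer φ g'.1 x‖ ≤ c * (E / G) :=
      ((hφ.lipschitz g.1 g.2 g'.1 g'.2 x hx.1).trans h1).trans hη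
    have h5 : ∀ p, ‖partialDeriv p (addModLayer φ g.1) x - partialDeriv p (addModLayer φ g'.1) x‖ ≤
        c * (E / G) := by
      intro p
      refine (hφ.lipschitz_deriv g.1 g.2 g'.1 g'.2 x hx.1 p).trans ?_
      have h6 : Bφ' * ‖g.1 x - g'.1 x‖ ≤ |Bφ'| * (E / G) :=
        mul_le_mul (le_abs_self _) h1 (norm_nonneg _) (abs_nonneg _)
      have p1 : 0 ≤ |Bg| * (E / G) := by positivity
      have p2 : 0 ≤ |Bg'| * (E / G) := by positivity
      have h7 : c * (E / G) = E / G + |Bg| * (E / G) + |Bg'| * (E / G) + |Bφ'| * (E / G) := by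
        rw [hc]; ring
      linarith [h2 p]
    refine (abs_lossDensity_sub_le hd hM hx.2.1 hx.2.2 hK (hF g x hx.1).1 (hF g x hx.1).2
      (hF g' x hx.1).1 (hF g' x hx.1).2 (by positivity) h4 h5).trans (le_of_eq ?_)
    rw [hq]; ring
  -- Arbitrary precision serves only the measurability of the supremum.
  have hcode' : ∀ ε > 0, ∃ (κ : Type) (_ : Finite κ) (e : 𝒩 → κ),
      ∀ g g', e g = e g' → ∀ x ∈ S, |Γ g x - Γ g' x| ≤ ε := by
    intro ε hε
    set K := 8 * q * d ^ 2 * A * E with hKdef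
    have hK0 : 0 < K := by positivity
    obtain ⟨G, hG⟩ := exists_nat_gt (max 1 (K / ε))
    have hG1 : (1 : ℝ) < G := (le_max_left _ _).trans_lt hG
    have hG2 : K / ε < G := (le_max_right _ _).trans_lt hG
    obtain ⟨e, he⟩ := hcode G (by exact_mod_cast hG1.le)
    refine ⟨_, inferInstance, e, fun g g' hgg x hx => (he g g' hgg x hx).trans ?_⟩
    have h1 : 8 * q * d ^ 2 * A * (E / G) = K / G := by rw [hKdef]; ring
    rw [h1, div_le_iff₀ (by linarith)]
    rw [div_lt_iff₀ hε] at hG2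
    linarith
  -- The mesh makes `E / G ≤ 1 / N`, below the order `1 / √N`; its size matters only through `log
  -- G`.
  set G := ⌈(N : ℝ) * E⌉₊ with hGdef
  have hNE : 0 < (N : ℝ) * E := by positivity
  have hG1 : 1 ≤ G := Nat.one_le_iff_ne_zero.2 (Nat.ceil_pos.2 hNE).ne'
  have hGle : (N : ℝ) * E ≤ G := Nat.le_ceil _
  have hGlt : (G : ℝ) ≤ N * (2 * (nD * B)) ^ (2 * (m + 1)) * (nD * B) + 1 := by
    refine (Nat.ceil_lt_add_one hNE.le).le.trans (le_of_eq ?_)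
    rw [hE]; ring
  obtain ⟨e, he⟩ := hcode G hG1
  have hlog2 : 1 / 2 ≤ Real.log Λ :=
    (by linarith [Real.log_two_gt_d9] : (1 : ℝ) / 2 ≤ Real.log 2).trans
      (Real.log_le_log two_pos hΛ2)
  set ε := 8 * q * d ^ 2 * A * (1 / N) with hε
  have he' : ∀ g g', e g = e g' → ∀ x ∈ S, |Γ g x - Γ g' x| ≤ ε := by
    intro g g' hgg x hx
    refine (he g g' hgg x hx).trans ?_
    have hEG : E / G ≤ 1 / N := by
      rw [div_le_div_iff₀ (by exact_mod_cast hG1) hN0]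
      linarith
    rw [hε]
    gcongr
  set T := ((m + 1 : ℕ) : ℝ) * nD * Real.log Λ with hT
  have hT1 : 1 / 2 ≤ T := by
    have : 1 ≤ ((m + 1 : ℕ) : ℝ) * nD := one_le_mul_of_one_le_of_one_le hD1 hn1
    calc (1 : ℝ) / 2 = 1 * (1 / 2) := by ring
      _ ≤ T := by rw [hT]; gcongr
  have hcard : Real.log (Nat.card (Fin nD → (Fin (m + 1) × Fin (nD + (d + 1)) ×
      Option (Fin (nD + (d + 1)))) × Fin (2 * G + 1))) ≤ 16 * T := by
    have h1 : (Nat.card (Fin nD → (Fin (m + 1) × Fin (nD + (d + 1)) ×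
        Option (Fin (nD + (d + 1)))) × Fin (2 * G + 1)) : ℝ) =
        (((m + 1 : ℕ) : ℝ) * ((nD + (d + 1)) * (nD + (d + 1) + 1)) * (2 * G + 1)) ^ nD := by
      simp [Nat.card_eq_fintype_card]
    rw [h1, Real.log_pow]
    have h2 := code_card_le hd (Nat.succ_le_succ (Nat.zero_le m)) hn hN hB hΛ hΛ2 hGlt
    have h3 := Real.log_le_log (by positivity) h2
    rw [Real.log_pow] at h3
    calc (nD : ℝ) * Real.log (((m + 1 : ℕ) : ℝ) * ((nD + (d + 1)) * (nD + (d + 1) + 1)) *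
          (2 * G + 1)) ≤ nD * (((16 * (m + 1) : ℕ) : ℝ) * Real.log Λ) := by gcongr
      _ = 16 * T := by rw [hT]; push_cast; ring
  have hR : 2 * ε + b / √N * √(2 * (16 * T)) ≤
      56 * q * ((d : ℝ) ^ 2 * A ^ 2 * √T / √N) := by
    have hbq : b = 4 * q * d ^ 2 * A ^ 2 := by rw [hb, hq]; ring
    rw [hbq, hε]
    exact two_mul_add_rate_le hq0.le hA1 hN1 hT1
  have hmain : ∀ s : ℝ, (s = 1 ∨ s = -1) → _ := fun s hs =>
    integral_sSup_meanDeviation_le (G := Γ) hS (fun g => ((hΓm g).aemeasurable.smul_measure _)) hb0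
      hΓb hcode' (L := 16 * T) (by linarith) (ε := ε) (by positivity) e he' hcard hN
      (t := s * (volume Ω).toReal) (by
        have h1 : (volume Ω).toReal ≤ 1 := by
          simpa using ENNReal.toReal_mono ENNReal.one_ne_top hvol1
        rcases hs with rfl | rfl
        · rwa [one_mul, abs_of_nonneg ENNReal.toReal_nonneg]
        · rwa [neg_one_mul, abs_neg, abs_of_nonneg ENNReal.toReal_nonneg])
  refine ⟨?_, fun s hs => ?_, fun s hs => ?_, fun s hs => ?_⟩
  · rintro _ ⟨g, hg, rfl⟩
    have : IsFiniteMeasure (volume.restrict Ω) := ⟨by simpa using hvolt.lt_top⟩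
    exact Integrable.of_bound (hΓm ⟨g, hg⟩) b (hSr.mono fun x hx => hΓb ⟨g, hg⟩ x hx)
  all_goals
    simp only [modifiedClass, deviations_eq_range hvol0 hvolt]
  · exact (hmain s hs).1
  · exact (hmain s hs).2.1
  · exact (hmain s hs).2.2.trans hR

theorem StatisticalErrorLE.mono {d : ℕ} {Ω : Set (EuclideanSpace ℝ (Fin d))}
    {ω f : EuclideanSpace ℝ (Fin d) → ℝ}
    {𝒢 : Set (EuclideanSpace ℝ (Fin d) → EuclideanSpace ℝ (Fin (d + 1)))} {N : ℕ} {R R' : ℝ}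
    (h : StatisticalErrorLE Ω ω f 𝒢 N R) (hR : R ≤ R') : StatisticalErrorLE Ω ω f 𝒢 N R' :=
  ⟨h.integrableOn, h.bddAbove, h.integrable, fun s hs => (h.integral_le s hs).trans hR⟩

theorem exists_isTameActivation {ρ : ℝ → ℝ} (h : ρ = Real.sigmoid ∨ ρ = Real.tanh) :
    ∃ ρ', IsTameActivation ρ ρ' := by
  rcases h with rfl | rfl
  · exact ⟨_, isTameActivation_sigmoid⟩
  · exact ⟨_, isTameActivation_tanh⟩

/-- A network with a single layer has at most `(d + 1) ^ 2` weights. -/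
theorem networkClass_one_eq (d : ℕ) (ρ : ℝ → ℝ) (nD : ℕ) (B : ℝ) :
    networkClass d ρ 1 nD B = networkClass d ρ 1 (min nD ((d + 1) ^ 2)) B := by
  have key : ∀ net : Net d 1 (d + 1), net.numNonzero ≤ (d + 1) ^ 2 := by
    intro net
    cases net with
    | layer prev A b =>
      cases prev
      have h1 := Set.ncard_le_card {ij : Fin (d + 1) × Fin d | A ij.1 ij.2 ≠ 0}
      have h2 := Set.ncard_le_card {i : Fin (d + 1) | b i ≠ 0}
      simp only [Nat.card_eq_fintype_card, Fintype.card_prod, Fintype.card_fin] at h1 h2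
      simp only [Net.numNonzero]
      nlinarith
  ext g
  constructor
  · rintro ⟨net, h1, h2, h3⟩
    exact ⟨net, le_min h1 (key net), h2, h3⟩
  · rintro ⟨net, h1, h2, h3⟩
    exact ⟨net, h1.trans (min_le_left _ _), h2, h3⟩

end MIM

end

/-! ### Comparison with the stated rate -/

theorem mainTheorem2 :
    -- for given data of the problem, a constant that depends on these data only
    (∀ (d : ℕ), 1 ≤ d →
      ∀ (Ω : Set (EuclideanSpace ℝ (Fin d))), IsOpen Ω → Ω.Nonempty →
      (∀ x ∈ Ω, ∀ i, 0 ≤ x i ∧ x i ≤ 1) →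
      ∀ (ω f : EuclideanSpace ℝ (Fin d) → ℝ),
      MemLp ω ⊤ (volume.restrict Ω) → MemLp f ⊤ (volume.restrict Ω) →
      ∀ (Bg Bg' Bφ' : ℝ),
      ∃ C : ℝ, 0 < C ∧
        ∀ (ρ : ℝ → ℝ), (ρ = Real.sigmoid ∨ ρ = Real.tanh) →
        ∀ (D nD N : ℕ) (Bθ : ℝ), 1 ≤ D → 1 ≤ nD → 1 ≤ N → 1 ≤ Bθ →
        2 ≤ (d : ℝ) * D * nD * Bθ * N →
        ∀ (φ : EuclideanSpace ℝ (Fin d) → EuclideanSpace ℝ (Fin (d + 1)) →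
            EuclideanSpace ℝ (Fin (d + 1))),
        MIM.IsModificationLayer Ω (MIM.networkClass d ρ D nD Bθ) φ Bg Bg' Bφ' →
        MIM.StatisticalErrorLE Ω ω f (MIM.modifiedClass d φ ρ D nD Bθ) N
          (C * ((d : ℝ) * √(D : ℝ) * (nD : ℝ) ^ (2 * D) * Bθ ^ (2 * D) / √(N : ℝ)) *
            √(Real.log ((d : ℝ) * D * nD * Bθ * N)))) ∧
    -- for at least two layers and `d ≤ nD`, a constant that does not depend on the dimension
    (∀ (M Bg Bg' Bφ' : ℝ),
      ∃ C : ℝ, 0 < C ∧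
        ∀ (d : ℕ), 1 ≤ d →
        ∀ (Ω : Set (EuclideanSpace ℝ (Fin d))), IsOpen Ω → Ω.Nonempty →
        (∀ x ∈ Ω, ∀ i, 0 ≤ x i ∧ x i ≤ 1) →
        ∀ (ω f : EuclideanSpace ℝ (Fin d) → ℝ),
        MemLp ω ⊤ (volume.restrict Ω) → MemLp f ⊤ (volume.restrict Ω) →
        eLpNorm ω ⊤ (volume.restrict Ω) ≤ ENNReal.ofReal M →
        eLpNorm f ⊤ (volume.restrict Ω) ≤ ENNReal.ofReal M →
        ∀ (ρ : ℝ → ℝ), (ρ = Real.sigmoid ∨ ρ = Real.tanh) →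
        ∀ (D nD N : ℕ) (Bθ : ℝ), 2 ≤ D → d ≤ nD → 1 ≤ N → 1 ≤ Bθ →
        ∀ (φ : EuclideanSpace ℝ (Fin d) → EuclideanSpace ℝ (Fin (d + 1)) →
            EuclideanSpace ℝ (Fin (d + 1))),
        MIM.IsModificationLayer Ω (MIM.networkClass d ρ D nD Bθ) φ Bg Bg' Bφ' →
        MIM.StatisticalErrorLE Ω ω f (MIM.modifiedClass d φ ρ D nD Bθ) N
          (C * ((d : ℝ) * √(D : ℝ) * (nD : ℝ) ^ (2 * D) * Bθ ^ (2 * D) / √(N : ℝ)) *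
            √(Real.log ((d : ℝ) * D * nD * Bθ * N)))) := by
  have hsqrt_le : ∀ y : ℝ, 1 ≤ y → √y ≤ y := fun y hy => by
    rw [Real.sqrt_le_left (by linarith)]
    nlinarith
  have hrate : ∀ (n D : ℕ) (Λ : ℝ), √((D : ℝ) * n * Real.log Λ) =
      √(D : ℝ) * √(n : ℝ) * √(Real.log Λ) := fun n D Λ => by
    rw [Real.sqrt_mul (by positivity), Real.sqrt_mul (by positivity)]
  have hpos : ∀ M Bg Bg' Bφ' : ℝ, 0 ≤ M →
      0 < 56 * ((1 + M) ^ 2 * (1 + |Bg| + |Bg'| + |Bφ'|) ^ 2) := fun M Bg Bg' Bφ' hM => by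
    positivity
  constructor
  · intro d hd Ω hΩo hΩn hΩ ω f hω hf Bg Bg' Bφ'
    have hd1 : (1 : ℝ) ≤ d := by exact_mod_cast hd
    set M := max (eLpNorm ω ⊤ (volume.restrict Ω)).toReal (eLpNorm f ⊤ (volume.restrict Ω)).toReal
    have hM : 0 ≤ M := le_max_of_le_left ENNReal.toReal_nonneg
    have hωM := MIM.ae_abs_le_of_eLpNorm_top_le hM
      ((ENNReal.le_ofReal_iff_toReal_le hω.2.ne hM).2 (le_max_left _ _))
    have hfM := MIM.ae_abs_le_of_eLpNorm_top_le hM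
      ((ENNReal.le_ofReal_iff_toReal_le hf.2.ne hM).2 (le_max_right _ _))
    set C₀ := 56 * ((1 + M) ^ 2 * (1 + |Bg| + |Bg'| + |Bφ'|) ^ 2) with hC₀
    have hC₀pos : 0 < C₀ := hpos M Bg Bg' Bφ' hM
    -- One factor `d` reduces `d²` to `d`; the factor `d + 1` bounds `√nD` at depth one, after `nD`
    -- has been truncated at `(d + 1)²`.
    refine ⟨C₀ * (d * (d + 1)), by positivity, ?_⟩
    intro ρ hρ D nD N B hD hn hN hB hΛ2 φ hφ
    obtain ⟨ρ', hρ'⟩ := MIM.exists_isTameActivation hρ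
    have hn1 : (1 : ℝ) ≤ nD := by exact_mod_cast hn
    have hN1 : (1 : ℝ) ≤ N := by exact_mod_cast hN
    obtain ⟨m, rfl⟩ : ∃ m, D = m + 1 := ⟨D - 1, by omega⟩
    rcases Nat.eq_zero_or_pos m with rfl | hm
    · rw [MIM.networkClass_one_eq] at hφ
      rw [MIM.modifiedClass, MIM.networkClass_one_eq, ← MIM.modifiedClass]
      set n' := min nD ((d + 1) ^ 2) with hn'
      have hn'1 : 1 ≤ n' := le_min hn (Nat.one_le_pow _ _ (by omega))
      have hn'r : (1 : ℝ) ≤ n' := by exact_mod_cast hn'1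
      have hle : (n' : ℝ) ≤ nD := by exact_mod_cast min_le_left _ _
      have hle2 : (n' : ℝ) ≤ (d + 1) ^ 2 := by
        have : n' ≤ (d + 1) ^ 2 := min_le_right _ _
        exact_mod_cast this
      -- Truncating `nD` could violate `2 ≤ Λ`; if it takes effect, then `n' = (d + 1)²` is already
      -- at least two.
      have hΛ' : 2 ≤ (d : ℝ) * (0 + 1 : ℕ) * n' * B * N := by
        rcases min_choice nD ((d + 1) ^ 2) with h | h
        · rwa [hn', h]
        · have h4 : (2 : ℝ) ≤ n' := by
            rw [hn', h]
            push_cast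
            nlinarith
          calc (2 : ℝ) = 1 * (0 + 1 : ℕ) * 2 * 1 * 1 := by norm_num
            _ ≤ (d : ℝ) * (0 + 1 : ℕ) * n' * B * N := by gcongr
      refine (MIM.statisticalErrorLE_modifiedClass hd hΩo hΩn hΩ hω.1 hf.1 hM hωM hfM hρ' hn'1 hN
        hB rfl hΛ' hφ).mono ?_
      rw [← hC₀, hrate]
      have hlog : √(Real.log ((d : ℝ) * (0 + 1 : ℕ) * n' * B * N)) ≤
          √(Real.log ((d : ℝ) * (0 + 1 : ℕ) * nD * B * N)) := by
        gcongr
      have hs : √(n' : ℝ) ≤ d + 1 := by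
        rw [Real.sqrt_le_left (by positivity)]
        exact hle2
      calc C₀ * ((d : ℝ) ^ 2 * ((n' : ℝ) ^ max 0 1 * B ^ (0 + 1)) ^ 2 *
            (√((0 + 1 : ℕ) : ℝ) * √(n' : ℝ) *
              √(Real.log ((d : ℝ) * (0 + 1 : ℕ) * n' * B * N))) / √(N : ℝ))
          ≤ C₀ * ((d : ℝ) ^ 2 * ((nD : ℝ) ^ max 0 1 * B ^ (0 + 1)) ^ 2 *
            (√((0 + 1 : ℕ) : ℝ) * (d + 1) *
              √(Real.log ((d : ℝ) * (0 + 1 : ℕ) * nD * B * N))) / √(N : ℝ)) := by gcongr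
        _ = _ := by
          simp only [zero_add, Nat.cast_one, Real.sqrt_one, zero_le, sup_of_le_right, pow_one]
          ring
    · refine (MIM.statisticalErrorLE_modifiedClass hd hΩo hΩn hΩ hω.1 hf.1 hM hωM hfM hρ' hn hN
        hB rfl hΛ2 hφ).mono ?_
      rw [← hC₀, hrate, max_eq_left hm]
      set ℒ := √(Real.log ((d : ℝ) * (m + 1 : ℕ) * nD * B * N))
      -- At depth `m + 1 ≥ 2` the square of `nD^m` falls short of `nD^(2(m+1))` by `nD²`, which
      -- absorbs `√nD`.
      have hs : √(nD : ℝ) ≤ (d + 1) * nD ^ 2 := by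
        calc √(nD : ℝ) ≤ nD := hsqrt_le _ hn1
          _ ≤ nD ^ 2 := le_self_pow₀ hn1 two_ne_zero
          _ ≤ (d + 1) * nD ^ 2 := le_mul_of_one_le_left (by positivity) (by linarith)
      calc C₀ * ((d : ℝ) ^ 2 * ((nD : ℝ) ^ m * B ^ (m + 1)) ^ 2 *
            (√((m + 1 : ℕ) : ℝ) * √(nD : ℝ) * ℒ) / √(N : ℝ))
          ≤ C₀ * ((d : ℝ) ^ 2 * ((nD : ℝ) ^ m * B ^ (m + 1)) ^ 2 *
            (√((m + 1 : ℕ) : ℝ) * ((d + 1) * nD ^ 2) * ℒ) / √(N : ℝ)) := by gcongr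
        _ = _ := by ring
  · intro M₀ Bg Bg' Bφ'
    -- `M₀` may be negative, in which case `ENNReal.ofReal M₀ = 0`.
    set M := max M₀ 0
    have hM : 0 ≤ M := le_max_right _ _
    set C₀ := 56 * ((1 + M) ^ 2 * (1 + |Bg| + |Bg'| + |Bφ'|) ^ 2) with hC₀
    have hC₀pos : 0 < C₀ := hpos M Bg Bg' Bφ' hM
    refine ⟨C₀, hC₀pos, ?_⟩
    intro d hd Ω hΩo hΩn hΩ ω f hω hf hωM hfM ρ hρ D nD N B hD hn hN hB φ hφ
    have hMM : ENNReal.ofReal M₀ ≤ ENNReal.ofReal M := ENNReal.ofReal_le_ofReal (le_max_left _ _)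
    obtain ⟨ρ', hρ'⟩ := MIM.exists_isTameActivation hρ
    have hd1 : (1 : ℝ) ≤ d := by exact_mod_cast hd
    have hdn : (d : ℝ) ≤ nD := by exact_mod_cast hn
    have hn1 : (1 : ℝ) ≤ nD := hd1.trans hdn
    have hN1 : (1 : ℝ) ≤ N := by exact_mod_cast hN
    obtain ⟨m, rfl⟩ : ∃ m, D = m + 1 := ⟨D - 1, by omega⟩
    have hm1 : (2 : ℝ) ≤ (m + 1 : ℕ) := by exact_mod_cast hD
    have hΛ2 : 2 ≤ (d : ℝ) * (m + 1 : ℕ) * nD * B * N := by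
      calc (2 : ℝ) = 1 * 2 * 1 * 1 * 1 := by ring
        _ ≤ (d : ℝ) * (m + 1 : ℕ) * nD * B * N := by gcongr
    refine (MIM.statisticalErrorLE_modifiedClass hd hΩo hΩn hΩ hω.1 hf.1 hM
      (MIM.ae_abs_le_of_eLpNorm_top_le hM (hωM.trans hMM))
      (MIM.ae_abs_le_of_eLpNorm_top_le hM (hfM.trans hMM)) hρ' (hd.trans hn) hN
      hB rfl hΛ2 hφ).mono ?_
    rw [← hC₀, hrate, max_eq_left (by omega)]
    set ℒ := √(Real.log ((d : ℝ) * (m + 1 : ℕ) * nD * B * N))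
    -- Here the spare `nD²` absorbs both `√nD` and the surplus factor `d ≤ nD`, so the constant is
    -- free of `d`.
    have hs : (d : ℝ) * √(nD : ℝ) ≤ nD ^ 2 := by
      rw [sq]
      exact mul_le_mul hdn (hsqrt_le _ hn1) (Real.sqrt_nonneg _) (by positivity)
    calc C₀ * ((d : ℝ) ^ 2 * ((nD : ℝ) ^ m * B ^ (m + 1)) ^ 2 *
          (√((m + 1 : ℕ) : ℝ) * √(nD : ℝ) * ℒ) / √(N : ℝ))
        = C₀ * (d * ((nD : ℝ) ^ m * B ^ (m + 1)) ^ 2 *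
          (√((m + 1 : ℕ) : ℝ) * ((d : ℝ) * √(nD : ℝ)) * ℒ) / √(N : ℝ)) := by ring
      _ ≤ C₀ * (d * ((nD : ℝ) ^ m * B ^ (m + 1)) ^ 2 *
          (√((m + 1 : ℕ) : ℝ) * nD ^ 2 * ℒ) / √(N : ℝ)) := by gcongr
      _ = _ := by ring
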